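/- Monoids are commutative with identity and zero; for a monoid $A$, an $A$-module is a pointed set with a compatible action of $A$ (with $0_A$ acting by the base point $0$). Let $(X,\mathcal O_X)$ be a monoid scheme of finite type (it has a finite covering by spectra of finitely generated monoids), and let $k$ be a field. A coherent sheaf $\mathcal F$ on $X$ (an $\mathcal O_X$-module locally of the form $\widetilde M$ with $M$ finitely generated) is of *type $\alpha$* if in every stalk $\mathcal F_x$, for $a\in\mathcal O_{X,x}$ and $s,t\in\mathcal F_x$, the equality $as=at$ implies $s=t$ or $as=at=0$. Let $\mathrm{Coh}^\alpha(X)$ be the category of coherent sheaves of type $\alpha$, with those morphisms of $\mathcal O_X$-modules that on every stalk are injective outside the preimage of $0$. For $\mathcal F,\mathcal F'\in\mathrm{Coh}^\alpha(X)$ let $\mathrm{Ext}_{\mathrm{Coh}^\alpha(X)}(\mathcal F',\mathcal F)$ be the set of equivalence classes of admissible short exact sequences $\mathcal F\hookrightarrow\mathcal G\twoheadrightarrow\mathcal F'$ in $\mathrm{Coh}^\alpha(X)$ (on stalks: injective, surjective, and the image of the first map is the preimage of $0$ under the second), two being equivalent if there is an isomorphism of the middle terms in $\mathrm{Coh}^\alpha(X)$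 inducing the identity on $\mathcal F$ and $\mathcal F'$. Let $X_k$ be the $k$-realization of $X$, the scheme glued from $\operatorname{Spec}k[\mathcal O_X(U)]$ for $U\subseteq X$ affine open, and let $\mathcal F\mapsto\mathcal F_k$ be the realization functor to $\mathcal O_{X_k}$-modules, where $\mathcal F_k$ is glued from the sheaves $\widetilde{k[\mathcal F(U)]}$. (Here $k[A]$ and $k[M]$ are the free $k$-modules on the non-zero elements of a monoid $A$ and of an $A$-module $M$, with the induced multiplication and action.) Then $\mathcal G_k$ is coherent for every $\mathcal G\in\mathrm{Coh}^\alpha(X)$; for every admissible short exact sequence $\mathcal F\hookrightarrow\mathcal G\twoheadrightarrow\mathcal F'$ in $\mathrm{Coh}^\alpha(X)$ the sequence $0\to\mathcal F_k\to\mathcal G_k\to\mathcal F'_k\to0$ is exact; and the resulting map $$\mathcal E_k:\ \mathrm{Ext}_{\mathrm{Coh}^\alpha(X)}(\mathcal F',\mathcal F)\longrightarrow \mathrm{Ext}^1_{\mathrm{Coh}(X_k)}(\mathcal F'_k,\mathcal F_k),\qquad [\mathcal F\hookrightarrow\mathcal G\twoheadrightarrow\mathcal F']\longmapsto[0\to\mathcal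 F_k\to\mathcal G_k\to\mathcal F'_k\to0],$$ to equivalence classes of extensions in $\mathrm{Coh}(X_k)$, is well defined and injective. -/

import Mathlib

open CategoryTheory CategoryTheory.Limits TopologicalSpace Topology Opposite AlgebraicGeometry

universe u

noncomputable section

/-! ### Prime spectra of monoids -/

/-- A prime ideal of a commutative monoid with zero: a subset containing `0`, stable under
multiplication by the monoid, proper, and with multiplicatively closed complement. -/
@[ext]
structure MSpec (A : Type u) [CommMonoidWithZero A] where
  carrier : Set A
  zero_mem : (0 : A) ∈ carrier
  mul_mem : ∀ (a : A) {b : A}, b ∈ carrier → a * b ∈ carrier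
  one_notMem : (1 : A) ∉ carrier
  mem_or_mem : ∀ {a b : A}, a * b ∈ carrier → a ∈ carrier ∨ b ∈ carrier

namespace MSpec

variable {A B : Type u} [CommMonoidWithZero A] [CommMonoidWithZero B]

/-- The basic open set `D(f)`: the primes not containing `f`. -/
def basicOpen (f : A) : Set (MSpec A) := {p | f ∉ p.carrier}

/-- The topology of `MSpec A` has the sets `D(f)` as a basis; equivalently, its closed sets
are the sets `V(I)` for ideals `I`. -/
instance : TopologicalSpace (MSpec A) :=
  TopologicalSpace.generateFrom (Set.range basicOpen)

theorem basicOpen_mul (f g : A) : basicOpen (f * g) = basicOpen f ∩ basicOpen g := by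
  ext p
  simp only [basicOpen, Set.mem_ofPred_eq, Set.mem_inter_iff]
  constructor
  · intro h
    exact ⟨fun hf => h (mul_comm g f ▸ p.mul_mem g hf), fun hg => h (p.mul_mem f hg)⟩
  · rintro ⟨hf, hg⟩ h
    exact (p.mem_or_mem h).elim hf hg

theorem basicOpen_one : basicOpen (1 : A) = Set.univ :=
  Set.eq_univ_of_forall fun p => p.one_notMem

theorem isTopologicalBasis_basicOpen :
    IsTopologicalBasis (Set.range (basicOpen : A → Set (MSpec A))) where
  exists_subset_inter := by
    rintro _ ⟨f, rfl⟩ _ ⟨g, rfl⟩ p hp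
    exact ⟨_, ⟨f * g, rfl⟩, by rwa [basicOpen_mul], (basicOpen_mul f g).subset⟩
  sUnion_eq := Set.eq_univ_of_forall fun p =>
    ⟨_, ⟨1, rfl⟩, by rw [basicOpen_one]; trivial⟩
  eq_generateFrom := rfl

theorem isOpen_basicOpen (f : A) : IsOpen (basicOpen f) :=
  isTopologicalBasis_basicOpen.isOpen ⟨f, rfl⟩

/-- The inverse image of a prime ideal. -/
def comap (φ : A →*₀ B) (p : MSpec B) : MSpec A where
  carrier := φ ⁻¹' p.carrier
  zero_mem := by simpa using p.zero_mem
  mul_mem a b hb := by simpa using p.mul_mem (φ a) hb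
  one_notMem := by simpa using p.one_notMem
  mem_or_mem h := p.mem_or_mem (by simpa using h)

theorem comap_preimage_basicOpen (φ : A →*₀ B) (f : A) :
    comap φ ⁻¹' basicOpen f = basicOpen (φ f) := rfl

theorem continuous_comap (φ : A →*₀ B) : Continuous (comap φ) :=
  isTopologicalBasis_basicOpen.continuous_iff.mpr (by
    rintro _ ⟨f, rfl⟩
    exact isOpen_basicOpen (φ f))

section Localization

variable {f : A} {φ : A →*₀ B}

theorem notMem_of_isUnit (p : MSpec A) {a : A} (ha : IsUnit a) : a ∉ p.carrier := by
  obtain ⟨u, rfl⟩ := ha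
  intro h
  exact p.one_notMem (by simpa using p.mul_mem (↑u⁻¹ : A) h)

theorem pow_notMem (p : MSpec A) {a : A} (ha : a ∉ p.carrier) (n : ℕ) : a ^ n ∉ p.carrier := by
  induction n with
  | zero => simpa using p.one_notMem
  | succ n ih =>
    rw [pow_succ]
    exact fun h => (p.mem_or_mem h).elim ih ha

theorem mem_carrier_iff (h : Submonoid.IsLocalizationMap (Submonoid.powers f) φ) (p : MSpec B)
    {b : B} {a : A} {n : ℕ} (hab : b * φ (f ^ n) = φ a) : b ∈ p.carrier ↔ φ a ∈ p.carrier := by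
  have hu : IsUnit (φ (f ^ n)) := h.map_units ⟨f ^ n, n, rfl⟩
  rw [← hab]
  constructor
  · intro hb
    rw [mul_comm]
    exact p.mul_mem _ hb
  · intro hb
    exact (p.mem_or_mem hb).resolve_right (p.notMem_of_isUnit hu)

theorem exists_num (h : Submonoid.IsLocalizationMap (Submonoid.powers f) φ) (b : B) :
    ∃ (a : A) (n : ℕ), b * φ (f ^ n) = φ a := by
  obtain ⟨⟨a, ⟨_, n, rfl⟩⟩, hx⟩ := h.surj b
  exact ⟨a, n, hx⟩

theorem comap_injective (h : Submonoid.IsLocalizationMap (Submonoid.powers f) φ) :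
    Function.Injective (comap φ) := by
  intro p q hpq
  ext b
  obtain ⟨a, n, hab⟩ := exists_num h b
  rw [mem_carrier_iff h p hab, mem_carrier_iff h q hab]
  exact Set.ext_iff.mp (congrArg MSpec.carrier hpq) a

theorem comap_image_basicOpen (h : Submonoid.IsLocalizationMap (Submonoid.powers f) φ)
    {b : B} {a : A} {n : ℕ} (hab : b * φ (f ^ n) = φ a) :
    comap φ '' basicOpen b = basicOpen (f * a) := by
  ext p
  constructor
  · rintro ⟨q, hq, rfl⟩
    rw [basicOpen_mul]
    refine ⟨?_, ?_⟩
    · exact q.notMem_of_isUnit (by simpa using h.map_units ⟨f, 1, pow_one f⟩)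
    · exact fun ha => hq ((mem_carrier_iff h q hab).mpr ha)
  · intro hp
    rw [basicOpen_mul] at hp
    obtain ⟨hpf, hpa⟩ := hp
    have key : ∀ {b : B} {a a' : A} {n n' : ℕ}, b * φ (f ^ n) = φ a → b * φ (f ^ n') = φ a' →
        a' ∈ p.carrier → a ∈ p.carrier := by
      intro b a a' n n' h1 h2 ha
      have h3 : φ (f ^ n' * a) = φ (f ^ n * a') := by
        rw [map_mul, map_mul, ← h1, ← h2]
        ac_rfl
      obtain ⟨⟨_, m, rfl⟩, hc⟩ := h.exists_of_eq h3
      have h4 : f ^ m * (f ^ n' * a) ∈ p.carrier := by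
        have : f ^ m * (f ^ n' * a) = f ^ m * (f ^ n * a') := hc
        rw [this]
        exact p.mul_mem _ (p.mul_mem _ ha)
      exact (p.mem_or_mem ((p.mem_or_mem h4).resolve_left (p.pow_notMem hpf m))).resolve_left
        (p.pow_notMem hpf n')
    let q : MSpec B :=
      { carrier := {b | ∃ (a : A) (n : ℕ), b * φ (f ^ n) = φ a ∧ a ∈ p.carrier}
        zero_mem := ⟨0, 0, by simp, p.zero_mem⟩
        mul_mem := by
          rintro b c ⟨a, n, h1, ha⟩
          obtain ⟨a', n', h2⟩ := exists_num h b
          refine ⟨a' * a, n' + n, ?_, p.mul_mem _ ha⟩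
          rw [map_mul, ← h1, ← h2, pow_add, map_mul]
          ac_rfl
        one_notMem := by
          rintro ⟨a, n, h1, ha⟩
          exact p.one_notMem (key (b := 1) (n := 0) (a := 1) (by simp) h1 ha)
        mem_or_mem := by
          rintro b c ⟨a, n, h1, ha⟩
          obtain ⟨a1, n1, h2⟩ := exists_num h b
          obtain ⟨a2, n2, h3⟩ := exists_num h c
          have h4 : b * c * φ (f ^ (n1 + n2)) = φ (a1 * a2) := by
            rw [map_mul, ← h2, ← h3, pow_add, map_mul]
            ac_rfl
          exact (p.mem_or_mem (key h4 h1 ha)).imp (fun h => ⟨_, _, h2, h⟩) (fun h => ⟨_, _, h3, h⟩) }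
    refine ⟨q, ?_, ?_⟩
    · rintro ⟨a', n', h1, ha'⟩
      exact hpa (key hab h1 ha')
    · ext a'
      constructor
      · rintro ⟨a'', n', h1, ha''⟩
        exact key (b := φ a') (n := 0) (by simp) h1 ha''
      · intro ha'
        exact ⟨a', 0, by simp, ha'⟩

theorem isOpenEmbedding_comap (h : Submonoid.IsLocalizationMap (Submonoid.powers f) φ) :
    IsOpenEmbedding (comap φ) := by
  refine .of_continuous_injective_isOpenMap (continuous_comap φ) (comap_injective h) ?_
  rw [isTopologicalBasis_basicOpen.isOpenMap_iff]
  rintro _ ⟨b, rfl⟩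
  obtain ⟨a, n, hab⟩ := exists_num h b
  rw [comap_image_basicOpen h hab]
  exact isOpen_basicOpen _

theorem range_comap (h : Submonoid.IsLocalizationMap (Submonoid.powers f) φ) :
    Set.range (comap φ) = basicOpen f := by
  rw [← Set.image_univ, ← basicOpen_one, comap_image_basicOpen h (a := 1) (n := 0) (by simp),
    mul_one]

/-- Localizing first at `f` and then at (a unit multiple of) the image of `a` amounts to
localizing at `f * a`. -/
theorem isLocalizationMap_of_comp {C : Type u} [CommMonoidWithZero C] {ψ : B →*₀ C} {γ : A →*₀ C}
    (hc : ∀ x, ψ (φ x) = γ x) (h : Submonoid.IsLocalizationMap (Submonoid.powers f) φ)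
    {g : B} {a : A} {n : ℕ} (hga : g * φ (f ^ n) = φ a)
    (hl : Submonoid.IsLocalizationMap (Submonoid.powers (f * a)) γ) :
    Submonoid.IsLocalizationMap (Submonoid.powers g) ψ := by
  have hu : ∀ n, IsUnit (φ (f ^ n)) := fun n => h.map_units ⟨f ^ n, n, rfl⟩
  have hu' : IsUnit (γ (f * a)) := hl.map_units ⟨f * a, 1, pow_one _⟩
  rw [map_mul] at hu'
  have hpow : ∀ m, φ ((f * a) ^ m) = g ^ m * φ (f ^ (m + n * m)) := by
    intro m
    rw [mul_pow, map_mul, map_pow φ a, ← hga, mul_pow, ← map_pow φ (f ^ n), ← pow_mul, pow_add,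
      map_mul]
    ac_rfl
  refine ⟨?_, ?_, ?_⟩
  · rintro ⟨_, m, rfl⟩
    have h1 : IsUnit (ψ g) := by
      refine isUnit_of_mul_isUnit_left (y := ψ (φ (f ^ n))) ?_
      rw [← map_mul, hga, hc]
      exact isUnit_of_mul_isUnit_right hu'
    simpa using h1.pow m
  · intro z
    obtain ⟨⟨b, ⟨_, m, rfl⟩⟩, hb⟩ := hl.surj z
    obtain ⟨w, hw⟩ := hu (m + n * m)
    refine ⟨⟨φ b * (w⁻¹ : Bˣ), ⟨g ^ m, m, rfl⟩⟩, ?_⟩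
    have hb' : z * ψ (g ^ m * w) = ψ (φ b) := by
      rw [hw, ← hpow, hc, hc]
      exact hb
    change z * ψ (g ^ m) = ψ (φ b * (w⁻¹ : Bˣ))
    rw [map_mul ψ (φ b), ← hb', mul_assoc, ← map_mul]
    simp
  · intro x y hxy
    obtain ⟨p, i, hp⟩ := exists_num h x
    obtain ⟨q, j, hq⟩ := exists_num h y
    have h1 : γ (p * f ^ j) = γ (q * f ^ i) := by
      rw [← hc, ← hc, map_mul φ p, map_mul φ q, ← hp, ← hq]
      simp only [map_mul, hxy]
      ac_rfl
    obtain ⟨⟨_, m, rfl⟩, hm⟩ := hl.exists_of_eq h1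
    have h2 : (f * a) ^ m * (p * f ^ j) = (f * a) ^ m * (q * f ^ i) := hm
    have h3 := congrArg φ h2
    rw [map_mul, map_mul φ ((f * a) ^ m), map_mul φ p, map_mul φ q, ← hp, ← hq, hpow] at h3
    refine ⟨⟨g ^ m, m, rfl⟩, ?_⟩
    change g ^ m * x = g ^ m * y
    refine (((hu (m + n * m)).mul (hu i)).mul (hu j)).mul_right_cancel ?_
    calc _ = g ^ m * φ (f ^ (m + n * m)) * (x * φ (f ^ i) * φ (f ^ j)) := by ac_rfl
      _ = _ := h3
      _ = _ := by ac_rfl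

end Localization

/-- The unique closed point of `MSpec A`: the ideal of non-units. -/
def closedPoint (A : Type u) [CommMonoidWithZero A] [Nontrivial A] : MSpec A where
  carrier := {a | ¬ IsUnit a}
  zero_mem := not_isUnit_zero
  mul_mem a b hb h := hb (isUnit_of_mul_isUnit_right h)
  one_notMem h := h isUnit_one
  mem_or_mem {a b} h := by
    by_contra! hc
    simp only [Set.mem_ofPred_eq, not_not] at hc
    exact h (hc.1.mul hc.2)

theorem eq_univ_of_closedPoint_mem [Nontrivial A] {S : Set (MSpec A)} (hS : IsOpen S)
    (h : closedPoint A ∈ S) : S = Set.univ := by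
  obtain ⟨_, ⟨f, rfl⟩, hf, hfS⟩ := isTopologicalBasis_basicOpen.exists_subset_of_mem_open h hS
  refine Set.eq_univ_of_forall fun p => hfS (p.notMem_of_isUnit ?_)
  simpa [basicOpen, closedPoint] using hf

end MSpec

/-! ### Monoidal spaces and monoid schemes -/

/-- A monoidal space: a topological space with a sheaf of commutative monoids with zero. -/
structure MonoidalSpace where
  space : TopCat.{u}
  presheaf : TopCat.Presheaf (Type u) space
  isSheaf : presheaf.IsSheaf
  [mon : ∀ U : Opens space, CommMonoidWithZero (presheaf.obj (op U))]
  map_zero : ∀ {U V : Opens space} (h : V ≤ U), presheaf.map (homOfLE h).op 0 = 0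
  map_one : ∀ {U V : Opens space} (h : V ≤ U), presheaf.map (homOfLE h).op 1 = 1
  map_mul : ∀ {U V : Opens space} (h : V ≤ U) (a b : presheaf.obj (op U)),
    presheaf.map (homOfLE h).op (a * b) =
      presheaf.map (homOfLE h).op a * presheaf.map (homOfLE h).op b

namespace MonoidalSpace

variable (X : MonoidalSpace.{u})

/-- The monoid of sections of the structure sheaf over `U`. -/
abbrev sec (U : Opens X.space) : Type u := X.presheaf.obj (op U)

instance (U : Opens X.space) : CommMonoidWithZero (X.sec U) := X.mon U

variable {X}

/-- Restriction of sections, as a morphism of monoids with zero. -/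
def res {U V : Opens X.space} (h : V ≤ U) : X.sec U →*₀ X.sec V where
  toFun := X.presheaf.map (homOfLE h).op
  map_zero' := X.map_zero h
  map_one' := X.map_one h
  map_mul' := X.map_mul h

theorem res_refl {U : Opens X.space} (a : X.sec U) : res le_rfl a = a := by
  change X.presheaf.map (𝟙 _) a = a
  simp

theorem res_res {U V W : Opens X.space} (h : V ≤ U) (h' : W ≤ V) (a : X.sec U) :
    res h' (res h a) = res (h'.trans h) a := by
  change X.presheaf.map (homOfLE h').op (X.presheaf.map (homOfLE h).op a) =
    X.presheaf.map (homOfLE (h'.trans h)).op a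
  rw [← ConcreteCategory.comp_apply, ← Functor.map_comp]
  rfl

/-- An affine chart on an open set `U`, that is an isomorphism of `(U, 𝒪|_U)` with
`(MSpec A, 𝒪_A)`, where `A = 𝒪(U)`: a homeomorphism of `MSpec A` with `U` under which
`A → 𝒪(D(f))` is the localization `A → A_f`, for every `f`.
(As the sets `D(f)` are a basis of `MSpec A`, this determines the sheaf `𝒪_A`.) -/
structure AffineChart (U : Opens X.space) where
  toFun : MSpec (X.sec U) → X.space
  isOpenEmbedding : IsOpenEmbedding toFun
  range_eq : Set.range toFun = U
  isLocalizationMap : ∀ (f : X.sec U) (V : Opens X.space) (h : V ≤ U),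
    (V : Set X.space) = toFun '' MSpec.basicOpen f →
      Submonoid.IsLocalizationMap (Submonoid.powers f) (res h)

/-- An open set `U` is affine if `(U, 𝒪|_U)` is isomorphic to an affine monoid scheme. -/
def IsAffineOpen (U : Opens X.space) : Prop := Nonempty (AffineChart U)

namespace AffineChart

variable {U : Opens X.space} (c : AffineChart U)

/-- The open subset of `U` corresponding to `D(f)`. -/
def basicOpen (f : X.sec U) : Opens X.space :=
  ⟨c.toFun '' MSpec.basicOpen f, c.isOpenEmbedding.isOpenMap _ (MSpec.isOpen_basicOpen f)⟩

theorem basicOpen_le (f : X.sec U) : c.basicOpen f ≤ U := by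
  rintro _ ⟨p, -, rfl⟩
  exact c.range_eq.subset ⟨p, rfl⟩

theorem isLocalizationMap_basicOpen (f : X.sec U) :
    Submonoid.IsLocalizationMap (Submonoid.powers f) (res (c.basicOpen_le f)) :=
  c.isLocalizationMap f _ _ rfl

/-- An affine open subset of an affine open set is basic. -/
theorem exists_eq_basicOpen {V : Opens X.space} (hV : IsAffineOpen V) (h : V ≤ U) :
    ∃ f, V = c.basicOpen f := by
  obtain ⟨d⟩ := hV
  rcases subsingleton_or_nontrivial (X.sec V) with hs | hn
  · refine ⟨0, ?_⟩
    have h1 : (V : Set X.space) = ∅ := by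
      rw [← d.range_eq, Set.range_eq_empty_iff]
      exact ⟨fun p => p.one_notMem (Subsingleton.elim (0 : X.sec V) 1 ▸ p.zero_mem)⟩
    have h2 : MSpec.basicOpen (0 : X.sec U) = ∅ :=
      Set.eq_empty_of_forall_notMem fun p hp => hp p.zero_mem
    ext x
    simp [basicOpen, h1, h2]
  · let x := d.toFun (MSpec.closedPoint _)
    have hxV : x ∈ (V : Set X.space) := d.range_eq.subset ⟨_, rfl⟩
    obtain ⟨p, hp⟩ : x ∈ Set.range c.toFun := c.range_eq.symm.subset (h hxV)
    obtain ⟨_, ⟨f, rfl⟩, hpf, hfV⟩ :=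
      MSpec.isTopologicalBasis_basicOpen.exists_subset_of_mem_open
        (show p ∈ c.toFun ⁻¹' V by simpa [hp] using hxV)
        (V.isOpen.preimage c.isOpenEmbedding.continuous)
    refine ⟨f, le_antisymm ?_ ?_⟩
    · have h1 := MSpec.eq_univ_of_closedPoint_mem
        (S := d.toFun ⁻¹' (c.basicOpen f)) ((c.basicOpen f).isOpen.preimage
          d.isOpenEmbedding.continuous) ⟨p, hpf, hp⟩
      intro y hy
      obtain ⟨q, rfl⟩ := d.range_eq.symm.subset hy
      exact h1.symm.subset (Set.mem_univ q)
    · rintro _ ⟨q, hq, rfl⟩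
      exact hfV hq

/-- Basic open subsets of affine open sets are affine. -/
theorem isAffineOpen_basicOpen (f : X.sec U) : IsAffineOpen (c.basicOpen f) := by
  have hf := c.isLocalizationMap_basicOpen f
  refine ⟨⟨c.toFun ∘ MSpec.comap (res (c.basicOpen_le f)),
    c.isOpenEmbedding.comp (MSpec.isOpenEmbedding_comap hf), ?_, ?_⟩⟩
  · rw [Set.range_comp, MSpec.range_comap hf]
    rfl
  · intro g V h hV
    obtain ⟨a, n, hga⟩ := MSpec.exists_num hf g
    rw [Set.image_comp, MSpec.comap_image_basicOpen hf hga] at hV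
    exact MSpec.isLocalizationMap_of_comp (res_res _ h) hf hga
      (c.isLocalizationMap (f * a) V (h.trans (c.basicOpen_le f)) hV)

end AffineChart
end MonoidalSpace

/-! ### Modules over monoids, linearization -/

/-- The `k`-linearization `k[M]` of a pointed set `M`: the free `k`-module on `M` in which the
base point is identified with zero. -/
abbrev Lin (k M : Type u) [CommRing k] [Zero M] : Type u :=
  (M →₀ k) ⧸ Submodule.span k {Finsupp.single (0 : M) (1 : k)}

namespace Lin

variable (k : Type u) [CommRing k] {M N P : Type u} [Zero M] [Zero N] [Zero P]

/-- The basis element of `k[M]` attached to an element of `M`. -/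
def of (m : M) : Lin k M := Submodule.Quotient.mk (Finsupp.single m 1)

theorem of_zero : of k (0 : M) = 0 :=
  (Submodule.Quotient.mk_eq_zero _).mpr (Submodule.mem_span_singleton_self _)

/-- The linear extension of a map of pointed sets. -/
def map (f : M → N) (hf : f 0 = 0) : Lin k M →ₗ[k] Lin k N :=
  Submodule.mapQ _ _ (Finsupp.lmapDomain k k f) (by
    rw [Submodule.span_le, Set.singleton_subset_iff]
    change Finsupp.lmapDomain k k f (Finsupp.single 0 1) ∈ Submodule.span k {Finsupp.single 0 1}
    simp [hf, Submodule.mem_span_singleton_self])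

variable {k}

theorem map_of (f : M → N) (hf : f 0 = 0) (m : M) : map k f hf (of k m) = of k (f m) := by
  simp [map, of]

theorem hom_ext {E : Type u} [AddCommGroup E] [Module k E] {f g : Lin k M →ₗ[k] E}
    (h : ∀ m, f (of k m) = g (of k m)) : f = g := by
  apply Submodule.linearMap_qext
  ext m
  exact h m

end Lin

/-- The monoid algebra `k[A]` of a monoid with zero, in which `0_A` is identified with `0`. -/
abbrev LinAlg (k A : Type u) [CommRing k] [CommMonoidWithZero A] : Type u :=
  MonoidAlgebra k A ⧸ Ideal.span {MonoidAlgebra.single (0 : A) (1 : k)}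

namespace LinAlg

variable (k : Type u) [CommRing k] {A B C : Type u} [CommMonoidWithZero A] [CommMonoidWithZero B]
  [CommMonoidWithZero C]

/-- The inclusion of `A` into `k[A]`. -/
def of : A →*₀ LinAlg k A where
  toFun a := Ideal.Quotient.mk _ (MonoidAlgebra.single a 1)
  map_zero' := Ideal.Quotient.eq_zero_iff_mem.mpr (Ideal.subset_span rfl)
  map_one' := rfl
  map_mul' a b := by rw [← map_mul, MonoidAlgebra.single_mul_single, one_mul]

variable {k} in
/-- The universal property of `k[A]`. -/
def lift {R : Type u} [Ring R] [Algebra k R] (φ : A →*₀ R) : LinAlg k A →ₐ[k] R :=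
  Ideal.Quotient.liftₐ _ (MonoidAlgebra.lift k R A (φ : A →* R)) (by
    intro a ha
    rw [← RingHom.mem_ker]
    refine (Ideal.span_le (I := RingHom.ker (MonoidAlgebra.lift k R A (φ : A →* R)))).mpr ?_ ha
    rw [Set.singleton_subset_iff]
    simp [RingHom.mem_ker])

variable {k} in
theorem lift_of {R : Type u} [Ring R] [Algebra k R] (φ : A →*₀ R) (a : A) :
    lift (k := k) φ (of k a) = φ a := by
  change MonoidAlgebra.lift k R A (φ : A →* R) (MonoidAlgebra.single a 1) = φ a
  simp

variable {k} in
theorem algHom_ext {R : Type u} [Semiring R] [Algebra k R] {f g : LinAlg k A →ₐ[k] R}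
    (h : ∀ a, f (of k a) = g (of k a)) : f = g := by
  apply Ideal.Quotient.algHom_ext
  apply MonoidAlgebra.algHom_ext
  · exact h
  · ext

/-- The ring homomorphism `k[A] → k[B]` induced by a morphism of monoids. -/
def map (φ : A →*₀ B) : LinAlg k A →ₐ[k] LinAlg k B := lift ((of k).comp φ)

theorem map_of (φ : A →*₀ B) (a : A) : map k φ (of k a) = of k (φ a) := lift_of _ a

theorem map_id (x : LinAlg k A) : map k (MonoidWithZeroHom.id A) x = x := by
  have : map k (MonoidWithZeroHom.id A) = AlgHom.id k (LinAlg k A) :=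
    algHom_ext fun a => map_of k _ a
  exact congr($this x)

theorem induction {p : LinAlg k A → Prop} (h0 : p 0) (hadd : ∀ x y, p x → p y → p (x + y))
    (hof : ∀ (r : k) (a : A), p (r • of k a)) (x : LinAlg k A) : p x := by
  obtain ⟨x, rfl⟩ := Ideal.Quotient.mk_surjective x
  induction x using MonoidAlgebra.induction_linear with
  | zero => simpa using h0
  | add x y hx hy => simpa using hadd _ _ hx hy
  | single a r =>
    have : (Ideal.Quotient.mk _ (MonoidAlgebra.single a r) : LinAlg k A) = r • of k a := by
      change _ = Ideal.Quotient.mk _ (r • MonoidAlgebra.single a (1 : k))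
      rw [MonoidAlgebra.smul_single, smul_eq_mul, mul_one]
    rw [this]
    exact hof r a

/-- Linearization carries `A → A_f` to the localization of `k[A]` at `f`. -/
theorem isLocalization {f : A} {φ : A →*₀ B}
    (h : Submonoid.IsLocalizationMap (Submonoid.powers f) φ) :
    letI := (map k φ).toRingHom.toAlgebra
    IsLocalization.Away (of k f) (LinAlg k B) := by
  let := (map k φ).toRingHom.toAlgebra
  have hu : IsUnit (φ f) := h.map_units ⟨f, 1, pow_one f⟩
  have huk : ∀ n : ℕ, IsUnit (map k φ (of k f ^ n)) := fun n => by
    rw [map_pow, map_of]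
    exact (hu.map (of k)).pow n
  refine ⟨?_, ?_, ?_⟩
  · rintro ⟨_, n, rfl⟩
    exact huk n
  · intro z
    suffices ∃ (n : ℕ) (x : LinAlg k A), z * map k φ (of k f ^ n) = map k φ x by
      obtain ⟨n, x, hx⟩ := this
      exact ⟨⟨x, ⟨_, n, rfl⟩⟩, hx⟩
    induction z using induction with
    | h0 => exact ⟨0, 0, by simp⟩
    | hadd x y hx hy =>
      obtain ⟨n, x', hx'⟩ := hx
      obtain ⟨m, y', hy'⟩ := hy
      refine ⟨n + m, x' * of k f ^ m + y' * of k f ^ n, ?_⟩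
      rw [pow_add, map_add, map_mul, map_mul (map k φ) x', map_mul (map k φ) y', ← hx', ← hy']
      ring
    | hof r b =>
      obtain ⟨⟨a, ⟨_, n, rfl⟩⟩, hx⟩ := h.surj b
      have hx' : b * φ (f ^ n) = φ a := hx
      refine ⟨n, r • of k a, ?_⟩
      rw [map_smul, map_of, ← hx', map_mul, map_pow φ, map_pow (of k), map_pow, map_of,
        smul_mul_assoc]
  · intro x y hxy
    -- the inverse map from `k[B]` to the localization of `k[A]`
    let L := Localization.Away (of k f)
    let ψ₀ : A →*₀ L := (algebraMap (LinAlg k A) L).toMonoidWithZeroHom.comp (of k)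
    have hψ₀ : ∀ n : ℕ, IsUnit (ψ₀ (f ^ n)) := fun n => by
      rw [map_pow]
      exact (IsLocalization.Away.algebraMap_isUnit (S := L) (of k f)).pow n
    choose num ex hne using fun b => MSpec.exists_num h b
    have key : ∀ {b : B} {a : A} {n : ℕ}, b * φ (f ^ n) = φ a →
        ψ₀ (num b) * ψ₀ (f ^ n) = ψ₀ a * ψ₀ (f ^ ex b) := by
      intro b a n hb
      have h1 : φ (num b * f ^ n) = φ (a * f ^ ex b) := by
        rw [map_mul, map_mul, ← hb, ← hne]
        ac_rfl
      obtain ⟨⟨_, m, rfl⟩, hm⟩ := h.exists_of_eq h1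
      have h2 : f ^ m * (num b * f ^ n) = f ^ m * (a * f ^ ex b) := hm
      have h3 := congrArg ψ₀ h2
      rw [map_mul, map_mul ψ₀ (f ^ m), map_mul, map_mul ψ₀ a] at h3
      exact (hψ₀ m).mul_left_cancel h3
    let ψ : B → L := fun b => ψ₀ (num b) * ((hψ₀ (ex b)).unit⁻¹ : Lˣ)
    have hψ : ∀ {b : B} {a : A} {n : ℕ}, b * φ (f ^ n) = φ a → ψ b * ψ₀ (f ^ n) = ψ₀ a := by
      intro b a n hb
      change ψ₀ (num b) * ((hψ₀ (ex b)).unit⁻¹ : Lˣ) * ψ₀ (f ^ n) = ψ₀ a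
      rw [mul_right_comm, key hb, mul_assoc, IsUnit.mul_val_inv, mul_one]
    have hψφ : ∀ a, ψ (φ a) = ψ₀ a := fun a => by
      simpa using hψ (b := φ a) (a := a) (n := 0) (by simp)
    let Ψ : B →*₀ L :=
      { toFun := ψ
        map_zero' := by simpa using hψφ 0
        map_one' := by simpa using hψφ 1
        map_mul' := by
          intro b c
          have h1 : b * c * φ (f ^ (ex b + ex c)) = φ (num b * num c) := by
            rw [map_mul φ (num b), ← hne, ← hne, pow_add, map_mul]
            ac_rfl
          have h2 := hψ h1
          rw [map_mul, ← hψ (hne b), ← hψ (hne c), pow_add, map_mul] at h2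
          refine ((hψ₀ (ex b)).mul (hψ₀ (ex c))).mul_right_cancel ?_
          rw [h2]
          ac_rfl }
    have hcomp : ∀ x, lift (k := k) Ψ (map k φ x) = algebraMap (LinAlg k A) L x := by
      intro x
      have : (lift (k := k) Ψ).comp (map k φ) = IsScalarTower.toAlgHom k (LinAlg k A) L := by
        apply algHom_ext
        intro a
        change lift Ψ (map k φ (of k a)) = algebraMap (LinAlg k A) L (of k a)
        rw [map_of, lift_of]
        exact hψφ a
      exact congr($this x)
    have h4 : algebraMap (LinAlg k A) L x = algebraMap (LinAlg k A) L y := by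
      rw [← hcomp, ← hcomp]
      exact congrArg _ hxy
    exact (IsLocalization.eq_iff_exists (Submonoid.powers (of k f)) L).mp h4

end LinAlg

namespace Lin

variable (k : Type u) [CommRing k] (A : Type u) {B M N : Type u}
  [CommMonoidWithZero A] [CommMonoidWithZero B]
  [Zero M] [MulActionWithZero A M] [Zero N] [MulActionWithZero A N]

/-- The action of `k[A]` on `k[M]`, for a module `M` over the monoid `A`. -/
def act : LinAlg k A →ₐ[k] Module.End k (Lin k M) :=
  LinAlg.lift
    { toFun a := Lin.map k (a • · : M → M) (smul_zero a)
      map_zero' := hom_ext fun m => by rw [Lin.map_of, zero_smul, of_zero]; rfl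
      map_one' := hom_ext fun m => by rw [Lin.map_of, one_smul]; rfl
      map_mul' a b := hom_ext fun m => by
        rw [Lin.map_of, mul_smul, Module.End.mul_apply, Lin.map_of, Lin.map_of] }

instance : Module (LinAlg k A) (Lin k M) := Module.compHom _ (act k A (M := M)).toRingHom

variable {A}

theorem of_smul_of (a : A) (m : M) : LinAlg.of k a • Lin.of k m = Lin.of k (a • m) := by
  change act k A (LinAlg.of k a) (Lin.of k m) = _
  rw [act, LinAlg.lift_of]
  exact Lin.map_of (a • · : M → M) (smul_zero a) m

theorem smul_algebra_smul (r : k) (x : LinAlg k A) (y : Lin k M) : (r • x) • y = r • (x • y) := by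
  change act k A (r • x) y = r • act k A x y
  rw [map_smul, LinearMap.smul_apply]

/-- The linear extension of a semilinear map of modules over monoids is semilinear. -/
theorem map_smul_of_semilinear {N' : Type u} [Zero N'] [MulActionWithZero B N'] (φ : A →*₀ B)
    (g : M → N') (hg : g 0 = 0) (h : ∀ (a : A) (m : M), g (a • m) = φ a • g m)
    (x : LinAlg k A) (y : Lin k M) :
    Lin.map k g hg (x • y) = LinAlg.map k φ x • Lin.map k g hg y := by
  induction x using LinAlg.induction with
  | h0 => 
    rw [_root_.map_zero (LinAlg.map k φ)]
    exact (congrArg _ (zero_smul (LinAlg k A) y)).trans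
      ((_root_.map_zero _).trans (zero_smul (LinAlg k B) (Lin.map k g hg y)).symm)
  | hadd x x' hx hx' => rw [add_smul, map_add, hx, hx', map_add, add_smul]
  | hof r a =>
    rw [smul_algebra_smul, LinearMap.map_smul, AlgHom.map_smul_of_tower, smul_algebra_smul,
      LinAlg.map_of]
    congr 1
    have : Lin.map k g hg ∘ₗ act k A (LinAlg.of k a) =
        act k B (LinAlg.of k (φ a)) ∘ₗ Lin.map k g hg := by
      apply hom_ext
      intro m
      change Lin.map k g hg (LinAlg.of k a • Lin.of k m) =
        LinAlg.of k (φ a) • Lin.map k g hg (Lin.of k m)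
      rw [of_smul_of, Lin.map_of, Lin.map_of, of_smul_of, h]
    exact congr($this y)

end Lin

/-- A monoid scheme: a monoidal space that is locally isomorphic to affine monoid schemes. -/
structure MonoidScheme extends MonoidalSpace.{u} where
  exists_isAffineOpen : ∀ x : space, ∃ U : Opens space,
    x ∈ U ∧ toMonoidalSpace.IsAffineOpen U

namespace MonoidScheme

variable (X : MonoidScheme.{u})

/-- `X` is of finite type: it has a finite covering by spectra of finitely generated monoids. -/
class IsFiniteType : Prop where
  exists_cover : ∃ 𝒰 : Set (Opens X.space), 𝒰.Finite ∧ (∀ x : X.space, ∃ U ∈ 𝒰, x ∈ U) ∧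
    ∀ U ∈ 𝒰, X.IsAffineOpen U ∧ Monoid.FG (X.sec U)

/-! ### The realization of a monoid scheme -/

/-- The affine open subsets of `X`, ordered by inclusion. -/
abbrev AffineOpens : Type u := {U : Opens X.space // X.IsAffineOpen U}

variable (k : Type u) [CommRing k]

/-- The ring homomorphism `k[𝒪(U)] → k[𝒪(V)]` induced by restriction. -/
def linRes {U V : Opens X.space} (h : V ≤ U) :
    CommRingCat.of (LinAlg k (X.sec U)) ⟶ CommRingCat.of (LinAlg k (X.sec V)) :=
  CommRingCat.ofHom (LinAlg.map k (MonoidalSpace.res h)).toRingHom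

/-- The diagram `U ↦ Spec k[𝒪(U)]` over the affine open subsets of `X`. -/
def realizationDiagram : X.AffineOpens ⥤ Scheme.{u} where
  obj U := Spec (CommRingCat.of (LinAlg k (X.sec U.1)))
  map {U V} h := Spec.map (X.linRes k (U := V.1) (V := U.1) h.le)
  map_id U := by
    have : X.linRes k (le_refl U.1) = 𝟙 _ := by
      apply CommRingCat.hom_ext
      apply RingHom.ext
      intro x
      have : LinAlg.map k (MonoidalSpace.res (le_refl U.1)) = AlgHom.id k _ := by
        apply LinAlg.algHom_ext
        intro a
        rw [LinAlg.map_of, MonoidalSpace.res_refl]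
        rfl
      exact congr($this x)
    change Spec.map (X.linRes k (le_refl U.1)) = _
    rw [this, Spec.map_id]
  map_comp {U V W} h h' := by
    rw [← Spec.map_comp]
    congr 1
    apply CommRingCat.hom_ext
    apply RingHom.ext
    intro x
    have : LinAlg.map k (MonoidalSpace.res (h.le.trans h'.le : U.1 ≤ W.1)) =
        (LinAlg.map k (MonoidalSpace.res (h.le : U.1 ≤ V.1))).comp
          (LinAlg.map k (MonoidalSpace.res (h'.le : V.1 ≤ W.1))) := by
      apply LinAlg.algHom_ext
      intro a
      rw [AlgHom.comp_apply, LinAlg.map_of, LinAlg.map_of, LinAlg.map_of, MonoidalSpace.res_res]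
    exact congr($this x)

theorem isOpenImmersion_linRes {U : Opens X.space} (c : X.AffineChart U) (f : X.sec U) :
    IsOpenImmersion (Spec.map (X.linRes k (c.basicOpen_le f))) := by
  let := (LinAlg.map k (MonoidalSpace.res (c.basicOpen_le f))).toRingHom.toAlgebra
  have := LinAlg.isLocalization k (c.isLocalizationMap_basicOpen f)
  exact IsOpenImmersion.of_isLocalization (LinAlg.of k f)

theorem mem_range_linRes {U : Opens X.space} (c : X.AffineChart U) (f : X.sec U)
    (x : PrimeSpectrum (LinAlg k (X.sec U))) :
    x ∈ Set.range (Spec.map (X.linRes k (c.basicOpen_le f))) ↔ LinAlg.of k f ∉ x.asIdeal := by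
  let := (LinAlg.map k (MonoidalSpace.res (c.basicOpen_le f))).toRingHom.toAlgebra
  have := LinAlg.isLocalization k (c.isLocalizationMap_basicOpen f)
  exact Set.ext_iff.mp (PrimeSpectrum.localization_away_comap_range (LinAlg k (X.sec (c.basicOpen f)))
    (LinAlg.of k f)) x

instance {U V : X.AffineOpens} (h : U ⟶ V) : IsOpenImmersion ((X.realizationDiagram k).map h) := by
  obtain ⟨U, hU⟩ := U
  obtain ⟨V, hV⟩ := V
  obtain ⟨c⟩ := hV
  obtain ⟨f, rfl⟩ := c.exists_eq_basicOpen hU h.le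
  exact X.isOpenImmersion_linRes k c f

instance : (X.realizationDiagram k ⋙ Scheme.forget).IsLocallyDirected where
  cond := by
    rintro ⟨U, hU⟩ ⟨V, hV⟩ ⟨W, hW⟩ hi hj xi xj hx
    obtain ⟨c⟩ := hW
    obtain ⟨f, rfl⟩ := c.exists_eq_basicOpen hU hi.le
    obtain ⟨g, rfl⟩ := c.exists_eq_basicOpen hV hj.le
    have hx' : (X.realizationDiagram k).map hi xi = (X.realizationDiagram k).map hj xj := hx
    have h1 : c.basicOpen (f * g) ≤ c.basicOpen f :=
      Set.image_mono ((MSpec.basicOpen_mul f g).trans_subset Set.inter_subset_left)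
    have h2 : c.basicOpen (f * g) ≤ c.basicOpen g :=
      Set.image_mono ((MSpec.basicOpen_mul f g).trans_subset Set.inter_subset_right)
    let l : X.AffineOpens := ⟨c.basicOpen (f * g), c.isAffineOpen_basicOpen _⟩
    let li : l ⟶ ⟨c.basicOpen f, hU⟩ := homOfLE h1
    let lj : l ⟶ ⟨c.basicOpen g, hV⟩ := homOfLE h2
    obtain ⟨x, hxl⟩ : (X.realizationDiagram k).map hi xi ∈
        Set.range ((X.realizationDiagram k).map (li ≫ hi)) := by
      refine (X.mem_range_linRes k c (f * g) _).mpr ?_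
      rw [map_mul]
      refine fun h => (((PrimeSpectrum.isPrime (R := LinAlg k (X.sec W)) _).mem_or_mem h).elim ?_ ?_)
      · exact (X.mem_range_linRes k c f _).mp ⟨xi, rfl⟩
      · exact (X.mem_range_linRes k c g _).mp ⟨xj, hx'.symm⟩
    refine ⟨l, li, lj, x, ?_, ?_⟩
    · apply ((X.realizationDiagram k).map hi).isOpenEmbedding.injective
      change ((X.realizationDiagram k).map hi) (((X.realizationDiagram k).map li) x) = _
      rw [← Scheme.Hom.comp_apply, ← Functor.map_comp, hxl]
    · apply ((X.realizationDiagram k).map hj).isOpenEmbedding.injective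
      change ((X.realizationDiagram k).map hj) (((X.realizationDiagram k).map lj) x) = _
      rw [← Scheme.Hom.comp_apply, ← Functor.map_comp, ← hx', ← hxl]
      rfl

/-- The `k`-realization `X_k`, obtained by gluing the schemes `Spec k[𝒪(U)]`, for `U ⊆ X` affine
open, along the open immersions `Spec k[𝒪(V)] → Spec k[𝒪(U)]` for `V ⊆ U`. -/
def realization : Scheme.{u} := colimit (X.realizationDiagram k)

/-- The open immersion `Spec k[𝒪(U)] → X_k`. -/
def realizationι (U : X.AffineOpens) :
    Spec (CommRingCat.of (LinAlg k (X.sec U.1))) ⟶ X.realization k :=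
  colimit.ι (X.realizationDiagram k) U

theorem map_realizationι {U V : X.AffineOpens} (h : V ≤ U) :
    Spec.map (X.linRes k h) ≫ X.realizationι k U = X.realizationι k V :=
  colimit.w (X.realizationDiagram k) (homOfLE h)

end MonoidScheme

/-! ### Sheaves of modules on monoidal spaces -/

/-- An `𝒪_X`-module: a sheaf of pointed sets with compatible actions of the monoids `𝒪_X(U)`. -/
structure OModule (X : MonoidalSpace.{u}) where
  presheaf : TopCat.Presheaf (Type u) X.space
  isSheaf : presheaf.IsSheaf
  [zero : ∀ U : Opens X.space, Zero (presheaf.obj (op U))]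
  [act : ∀ U : Opens X.space, MulActionWithZero (X.sec U) (presheaf.obj (op U))]
  map_zero : ∀ {U V : Opens X.space} (h : V ≤ U), presheaf.map (homOfLE h).op 0 = 0
  map_smul : ∀ {U V : Opens X.space} (h : V ≤ U) (a : X.sec U) (s : presheaf.obj (op U)),
    presheaf.map (homOfLE h).op (a • s) =
      MonoidalSpace.res h a • presheaf.map (homOfLE h).op s

namespace OModule

variable {X : MonoidalSpace.{u}}

/-- Sections of an `𝒪_X`-module. -/
abbrev sec (F : OModule X) (U : Opens X.space) : Type u := F.presheaf.obj (op U)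

instance (F : OModule X) (U : Opens X.space) : Zero (F.sec U) := F.zero U
instance (F : OModule X) (U : Opens X.space) : MulActionWithZero (X.sec U) (F.sec U) := F.act U

/-- Restriction of sections. -/
def res (F : OModule X) {U V : Opens X.space} (h : V ≤ U) (s : F.sec U) : F.sec V :=
  F.presheaf.map (homOfLE h).op s

theorem res_zero (F : OModule X) {U V : Opens X.space} (h : V ≤ U) :
    F.res h (0 : F.sec U) = 0 :=
  F.map_zero h

theorem res_smul (F : OModule X) {U V : Opens X.space} (h : V ≤ U) (a : X.sec U) (s : F.sec U) :
    F.res h (a • s) = MonoidalSpace.res h a • F.res h s :=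
  F.map_smul h a s

/-- A morphism of `𝒪_X`-modules. -/
@[ext]
structure Hom (F G : OModule X) where
  val : F.presheaf ⟶ G.presheaf
  map_zero : ∀ U : Opens X.space, val.app (op U) (0 : F.sec U) = (0 : G.sec U)
  map_smul : ∀ (U : Opens X.space) (a : X.sec U) (s : F.sec U),
    val.app (op U) (a • s : F.sec U) = (a • val.app (op U) s : G.sec U)

instance : Category (OModule X) where
  Hom := Hom
  id F := ⟨𝟙 _, fun _ => rfl, fun _ _ _ => rfl⟩
  comp f g := ⟨f.val ≫ g.val, fun U => by simp [f.map_zero, g.map_zero],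
    fun U a s => by simp [f.map_smul, g.map_smul]⟩

/-- The stalk `F_x`, as a set. -/
abbrev stalk (F : OModule X) (x : X.space) : Type u := F.presheaf.stalk x

/-- The germ of a section. -/
def germ (F : OModule X) {U : Opens X.space} {x : X.space} (hx : x ∈ U) (s : F.sec U) :
    F.stalk x :=
  F.presheaf.germ U x hx s

/-- The base point of the stalk. -/
instance (F : OModule X) (x : X.space) : Zero (F.stalk x) :=
  ⟨F.germ (U := ⊤) (Opens.mem_top x) 0⟩

/-- The map `F_x → G_x` induced by a morphism. -/
def Hom.stalkMap {F G : OModule X} (φ : F ⟶ G) (x : X.space) : F.stalk x → G.stalk x :=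
  (TopCat.Presheaf.stalkFunctor (Type u) x).map (Hom.val φ)

theorem germ_zero (F : OModule X) {U : Opens X.space} {x : X.space} (hx : x ∈ U) :
    F.germ hx (0 : F.sec U) = 0 := by
  change _ = F.germ (U := ⊤) (Opens.mem_top x) 0
  rw [germ, germ, ← F.map_zero (U := ⊤) (V := U) le_top, TopCat.Presheaf.germ_res_apply]

theorem Hom.stalkMap_germ {F G : OModule X} (φ : F ⟶ G) {U : Opens X.space} {x : X.space}
    (hx : x ∈ U) (s : F.sec U) :
    Hom.stalkMap φ x (F.germ hx s) = G.germ hx ((Hom.val φ).app (op U) s) :=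
  TopCat.Presheaf.stalkFunctor_map_germ_apply U x hx (Hom.val φ) s

theorem Hom.stalkMap_zero {F G : OModule X} (φ : F ⟶ G) (x : X.space) :
    Hom.stalkMap φ x 0 = 0 := by
  rw [← F.germ_zero (Opens.mem_top x), Hom.stalkMap_germ, φ.map_zero, germ_zero]

theorem Hom.stalkMap_id (F : OModule X) (x : X.space) (s : F.stalk x) :
    Hom.stalkMap (𝟙 F) x s = s :=
  congr($((TopCat.Presheaf.stalkFunctor (Type u) x).map_id F.presheaf) s)

theorem Hom.stalkMap_comp {F G H : OModule X} (φ : F ⟶ G) (ψ : G ⟶ H) (x : X.space)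
    (s : F.stalk x) : Hom.stalkMap (φ ≫ ψ) x s = Hom.stalkMap ψ x (Hom.stalkMap φ x s) :=
  congr($((TopCat.Presheaf.stalkFunctor (Type u) x).map_comp (Hom.val φ) (Hom.val ψ)) s)

/-- On the affine open set `U`, with chart `c`, the module `F` is the sheaf `M~` attached to
`M = F(U)`: for every `f ∈ 𝒪(U)`, the map `F(U) → F(D(f))` is the localization `M → M_f`. -/
structure IsTilde (F : OModule X) {U : Opens X.space} (c : X.AffineChart U) : Prop where
  surj : ∀ (f : X.sec U) (s : F.sec (c.basicOpen f)), ∃ (n : ℕ) (t : F.sec U),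
    MonoidalSpace.res (c.basicOpen_le f) (f ^ n) • s = F.res (c.basicOpen_le f) t
  exists_of_eq : ∀ (f : X.sec U) (s t : F.sec U),
    F.res (c.basicOpen_le f) s = F.res (c.basicOpen_le f) t → ∃ n : ℕ, f ^ n • s = f ^ n • t

/-- `F` is coherent: every point has an affine open neighbourhood on which `F` is isomorphic to
`M~` for a finitely generated module `M`. -/
def IsCoherent (F : OModule X) : Prop :=
  ∀ x : X.space, ∃ (U : Opens X.space) (c : X.AffineChart U), x ∈ U ∧ F.IsTilde c ∧
    ∃ S : Finset (F.sec U), ∀ m : F.sec U, ∃ (a : X.sec U), ∃ s ∈ S, m = a • s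

/-- `F` is of type `α`: in every stalk `F_x`, an equality `a • s = a • t` with `a ∈ 𝒪_{X,x}`
implies `s = t` or `a • s = a • t = 0`. (Finitely many elements of the stalks of `𝒪_X` and of `F`
at `x` are germs of sections over a common neighbourhood of `x`.) -/
def IsTypeAlpha (F : OModule X) : Prop :=
  ∀ (x : X.space) (U : Opens X.space) (hx : x ∈ U) (a : X.sec U) (s t : F.sec U),
    F.germ hx (a • s) = F.germ hx (a • t) →
      F.germ hx s = F.germ hx t ∨ (F.germ hx (a • s) = 0 ∧ F.germ hx (a • t) = 0)

/-- The morphisms of the category of type-`α` sheaves: on all stalks, the map is injective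
outside the preimage of the base point. -/
def Hom.IsTypeAlpha {F G : OModule X} (φ : F ⟶ G) : Prop :=
  ∀ (x : X.space) (s t : F.stalk x), Hom.stalkMap φ x s ≠ 0 →
    Hom.stalkMap φ x s = Hom.stalkMap φ x t → s = t

end OModule

/-- The objects of the category `Coh^α(X)`. -/
structure CohAlpha (X : MonoidScheme.{u}) where
  obj : OModule X.toMonoidalSpace
  isCoherent : obj.IsCoherent
  isTypeAlpha : obj.IsTypeAlpha

namespace CohAlpha

variable {X : MonoidScheme.{u}}

/-- The morphisms of the category `Coh^α(X)`. -/
@[ext]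
structure Hom (F G : CohAlpha X) where
  hom : F.obj ⟶ G.obj
  isTypeAlpha : OModule.Hom.IsTypeAlpha hom

instance : Category (CohAlpha X) where
  Hom := Hom
  id F := ⟨𝟙 _, fun x s t _ h => by rwa [OModule.Hom.stalkMap_id, OModule.Hom.stalkMap_id] at h⟩
  comp f g := ⟨f.hom ≫ g.hom, fun x s t h0 h => by
    rw [OModule.Hom.stalkMap_comp] at h0 h
    rw [OModule.Hom.stalkMap_comp] at h
    refine f.isTypeAlpha x s t (fun h1 => h0 ?_) (g.isTypeAlpha x _ _ h0 h)
    rw [h1, OModule.Hom.stalkMap_zero]⟩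

/-- The map on stalks induced by a morphism of `Coh^α(X)`. -/
abbrev stalkMap {F G : CohAlpha X} (φ : F ⟶ G) (x : X.space) : F.obj.stalk x → G.obj.stalk x :=
  OModule.Hom.stalkMap (Hom.hom φ) x

/-- An admissible extension of `F'` by `F` in `Coh^α(X)`, that is an admissible short exact
sequence `F ↪ G ↠ F'`: on stalks, the first map is an admissible monomorphism (it is injective),
the second one is an admissible epimorphism (it is surjective, and injective outside the preimage
of the base point, like all morphisms of `Coh^α(X)`), and the image of the first map is the kernel
of the second one, so that on stalks the sequence is isomorphic to `V ↪ M ↠ M / V` for a submodule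
`V` of `M`. -/
structure Extension (F' F : CohAlpha X) where
  mid : CohAlpha X
  i : F ⟶ mid
  p : mid ⟶ F'
  injective : ∀ x, Function.Injective (stalkMap i x)
  surjective : ∀ x, Function.Surjective (stalkMap p x)
  exact : ∀ x s, stalkMap p x s = 0 ↔ s ∈ Set.range (stalkMap i x)

/-- Equivalence of extensions: an isomorphism in `Coh^α(X)` of the middle terms that induces the
identity on the outer terms. -/
instance Extension.setoid (F' F : CohAlpha X) : Setoid (Extension F' F) where
  r E E' := ∃ e : E.mid ≅ E'.mid, E.i ≫ e.hom = E'.i ∧ e.hom ≫ E'.p = E.p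
  iseqv :=
    { refl := fun _ => ⟨Iso.refl _, Category.comp_id _, Category.id_comp _⟩
      symm := fun ⟨e, h1, h2⟩ => ⟨e.symm, by simp [← h1], by simp [← h2]⟩
      trans := fun ⟨e, h1, h2⟩ ⟨e', h1', h2'⟩ =>
        ⟨e ≪≫ e', by simp [← h1', ← h1], by simp [h2', h2]⟩ }

/-- The set `Ext_{Coh^α(X)}(F', F)` of equivalence classes of extensions of `F'` by `F`. -/
def Ext (F' F : CohAlpha X) : Type (u + 1) := Quotient (Extension.setoid F' F)

end CohAlpha

/-! ### Coherent sheaves on schemes and their extensions -/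

/-- An `𝒪_Y`-module on a (locally Noetherian) scheme is coherent if every point has an affine open
neighbourhood on which it is isomorphic to `N~` for a finitely generated module `N`. -/
def isCoherentModule (Y : Scheme.{u}) : ObjectProperty Y.Modules := fun M =>
  ∀ y : Y, ∃ (R : CommRingCat.{u}) (j : Spec R ⟶ Y) (_ : IsOpenImmersion j) (N : ModuleCat.{u} R),
    y ∈ Set.range j ∧ Module.Finite R N ∧ Nonempty (M.restrict j ≅ tilde N)

/-- The category `Coh(Y)`, as a full subcategory of the category of `𝒪_Y`-modules. -/
abbrev Coh (Y : Scheme.{u}) := (isCoherentModule Y).FullSubcategory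

namespace Coh

variable {Y : Scheme.{u}}

/-- An extension of `B` by `A` in `Coh(Y)`: a short exact sequence `0 → A → E → B → 0`. -/
structure Extension (B A : Coh Y) where
  mid : Coh Y
  i : A ⟶ mid
  p : mid ⟶ B
  zero : i.hom ≫ p.hom = 0
  shortExact : (ShortComplex.mk i.hom p.hom zero).ShortExact

/-- Equivalence of extensions. -/
instance Extension.setoid (B A : Coh Y) : Setoid (Extension B A) where
  r E E' := ∃ e : E.mid ≅ E'.mid, E.i ≫ e.hom = E'.i ∧ e.hom ≫ E'.p = E.p
  iseqv :=
    { refl := fun _ => ⟨Iso.refl _, Category.comp_id _, Category.id_comp _⟩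
      symm := fun ⟨e, h1, h2⟩ => ⟨e.symm, by simp [← h1], by simp [← h2]⟩
      trans := fun ⟨e, h1, h2⟩ ⟨e', h1', h2'⟩ =>
        ⟨e ≪≫ e', by simp [← h1', ← h1], by simp [h2', h2]⟩ }

/-- The set `Ext¹_{Coh(Y)}(B, A)` of equivalence classes of extensions of `B` by `A`. -/
def Ext (B A : Coh Y) : Type (u + 1) := Quotient (Extension.setoid B A)

end Coh

/-! ### The realization of sheaves of modules -/

section Tilde

variable {R S : CommRingCat.{u}} (r : R ⟶ S)

/-- Comparison of the global sections of `K` and of its direct image along `Spec S → Spec R`. -/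
def gammaPushforward (K : (Spec S).Modules) :
    (ModuleCat.restrictScalars r.hom).obj (moduleSpecΓFunctor.obj K) ⟶
      moduleSpecΓFunctor.obj ((Scheme.Modules.pushforward (Spec.map r)).obj K) :=
  ((pushforwardCompModulesSpecToSheafIso r).inv.app K).hom.app (op ⊤)

/-- The isomorphism of `N` with the global sections of `N~`. -/
def tildeUnit (N : ModuleCat.{u} S) : N ⟶ moduleSpecΓFunctor.obj (tilde N) :=
  (tilde.isoTop N).hom

/-- The morphism `M~ → r_* N~` of sheaves on `Spec R` attached to an `R`-linear map `M → N`, for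
a ring homomorphism `r : R → S` and an `S`-module `N`. -/
def tildeHom {M : ModuleCat.{u} R} {N : ModuleCat.{u} S}
    (g : M ⟶ (ModuleCat.restrictScalars r.hom).obj N) :
    tilde M ⟶ (Scheme.Modules.pushforward (Spec.map r)).obj (tilde N) :=
  (tilde.adjunction.homEquiv M _).symm
    (g ≫ (ModuleCat.restrictScalars r.hom).map (tildeUnit N) ≫ gammaPushforward r (tilde N))

theorem gammaPushforward_naturality {K L : (Spec S).Modules} (f : K ⟶ L) :
    (ModuleCat.restrictScalars r.hom).map (moduleSpecΓFunctor.map f) ≫ gammaPushforward r L =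
      gammaPushforward r K ≫
        moduleSpecΓFunctor.map ((Scheme.Modules.pushforward (Spec.map r)).map f) :=
  congr(($((pushforwardCompModulesSpecToSheafIso r).inv.naturality f)).hom.app (op ⊤))

theorem tildeHom_naturality {M M' : ModuleCat.{u} R} {N N' : ModuleCat.{u} S}
    (g : M ⟶ (ModuleCat.restrictScalars r.hom).obj N)
    (g' : M' ⟶ (ModuleCat.restrictScalars r.hom).obj N') (a : M ⟶ M') (b : N ⟶ N')
    (h : g ≫ (ModuleCat.restrictScalars r.hom).map b = a ≫ g') :
    tildeHom r g ≫ (Scheme.Modules.pushforward (Spec.map r)).map (tilde.map b) =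
      tilde.map a ≫ tildeHom r g' := by
  have h1 : tildeUnit N ≫ moduleSpecΓFunctor.map (tilde.map b) = b ≫ tildeUnit N' := (tilde.toTildeΓNatIso.hom.naturality b).symm
  have h2 := gammaPushforward_naturality r (tilde.map b)
  have h3 := congrArg (ModuleCat.restrictScalars r.hom).map h1
  rw [CategoryTheory.Functor.map_comp, CategoryTheory.Functor.map_comp] at h3
  unfold tildeHom
  refine (Adjunction.homEquiv_naturality_right_symm _ _ _).symm.trans (Eq.trans ?_ <|
    Adjunction.homEquiv_naturality_left_symm _ _ _)
  congr 1
  simp only [Category.assoc]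
  rw [← reassoc_of% h, ← reassoc_of% h3, h2]

end Tilde

namespace OModule

variable {X : MonoidScheme.{u}} (k : Type u) [CommRing k]

/-- The `k[𝒪(U)]`-module `k[F(U)]`. -/
def linSec (F : OModule X.toMonoidalSpace) (U : Opens X.space) :
    ModuleCat.{u} (CommRingCat.of (LinAlg k (X.sec U))) :=
  ModuleCat.of (LinAlg k (X.sec U)) (Lin k (F.sec U))

/-- The linear extension `k[F(U)] → k[F(V)]` of the restriction map. -/
def linSecRes (F : OModule X.toMonoidalSpace) {U V : Opens X.space} (h : V ≤ U) :
    F.linSec k U ⟶ (ModuleCat.restrictScalars (X.linRes k h).hom).obj (F.linSec k V) :=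
  ModuleCat.ofHom (Y := (ModuleCat.restrictScalars (X.linRes k h).hom).obj (F.linSec k V))
    { toFun := Lin.map k (F.res h) (F.res_zero h)
      map_add' := map_add _
      map_smul' := fun a m => Lin.map_smul_of_semilinear k (MonoidalSpace.res h) (F.res h)
        (F.res_zero h) (F.res_smul h) a m }

/-- The linear extension `k[F(U)] → k[G(U)]` of a morphism. -/
def linSecMap {F G : OModule X.toMonoidalSpace} (φ : F ⟶ G) (U : Opens X.space) :
    F.linSec k U ⟶ G.linSec k U :=
  ModuleCat.ofHom (X := Lin k (F.sec U)) (Y := Lin k (G.sec U))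
    { toFun := Lin.map k ((Hom.val φ).app (op U)) (Hom.map_zero φ U)
      map_add' := map_add _
      map_smul' := fun a m => by
        have h := Lin.map_smul_of_semilinear k (MonoidWithZeroHom.id (X.sec U))
          ((Hom.val φ).app (op U)) (Hom.map_zero φ U) (Hom.map_smul φ U) a m
        rwa [LinAlg.map_id] at h }

theorem linSecMap_id (F : OModule X.toMonoidalSpace) (U : Opens X.space) :
    linSecMap k (𝟙 F) U = 𝟙 _ := by
  ext m
  have : Lin.map k ((Hom.val (𝟙 F)).app (op U)) (Hom.map_zero (𝟙 F) U) = LinearMap.id :=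
    Lin.hom_ext fun m => Lin.map_of _ _ m
  exact congr($this m)

theorem linSecMap_comp {F G H : OModule X.toMonoidalSpace} (φ : F ⟶ G) (ψ : G ⟶ H)
    (U : Opens X.space) : linSecMap k (φ ≫ ψ) U = linSecMap k φ U ≫ linSecMap k ψ U := by
  ext m
  have : Lin.map k ((Hom.val (φ ≫ ψ)).app (op U)) (Hom.map_zero (φ ≫ ψ) U) =
      Lin.map k ((Hom.val ψ).app (op U)) (Hom.map_zero ψ U) ∘ₗ
        Lin.map k ((Hom.val φ).app (op U)) (Hom.map_zero φ U) :=
    Lin.hom_ext fun m => by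
      rw [LinearMap.comp_apply, Lin.map_of, Lin.map_of, Lin.map_of]
      rfl
  exact congr($this m)

theorem linSecMap_naturality {F G : OModule X.toMonoidalSpace} (φ : F ⟶ G) {U V : Opens X.space}
    (h : V ≤ U) :
    F.linSecRes k h ≫ (ModuleCat.restrictScalars (X.linRes k h).hom).map (linSecMap k φ V) =
      linSecMap k φ U ≫ G.linSecRes k h := by
  ext m
  have : Lin.map k ((Hom.val φ).app (op V)) (Hom.map_zero φ V) ∘ₗ
      Lin.map k (F.res h) (F.res_zero h) = Lin.map k (G.res h) (G.res_zero h) ∘ₗ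
        Lin.map k ((Hom.val φ).app (op U)) (Hom.map_zero φ U) :=
    Lin.hom_ext fun m => by
      rw [LinearMap.comp_apply, LinearMap.comp_apply, Lin.map_of (F.res h), Lin.map_of, Lin.map_of,
        Lin.map_of]
      exact congrArg _ (congr($((Hom.val φ).naturality (homOfLE h).op) m))
  exact congr($this m)

/-- The direct image on `X_k` of the sheaf `k[F(U)]~` on `Spec k[𝒪(U)]`. -/
abbrev piece (F : OModule X.toMonoidalSpace) (U : X.AffineOpens) : (X.realization k).Modules :=
  (Scheme.Modules.pushforward (X.realizationι k U)).obj (tilde (F.linSec k U.1))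

/-- The action of a morphism on the pieces. -/
def pieceMap {F G : OModule X.toMonoidalSpace} (φ : F ⟶ G) (U : X.AffineOpens) :
    F.piece k U ⟶ G.piece k U :=
  (Scheme.Modules.pushforward (X.realizationι k U)).map (tilde.map (linSecMap k φ U.1))

/-- The restriction maps between the pieces, for `V ⊆ U`. -/
def pieceRes (F : OModule X.toMonoidalSpace) {U V : X.AffineOpens} (h : V ≤ U) :
    F.piece k U ⟶ F.piece k V :=
  (Scheme.Modules.pushforward (X.realizationι k U)).map
      (tildeHom (X.linRes k h) (F.linSecRes k h)) ≫
    (Scheme.Modules.pushforwardComp (Spec.map (X.linRes k h)) (X.realizationι k U)).hom.app _ ≫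
    (Scheme.Modules.pushforwardCongr (X.map_realizationι k h)).hom.app _

theorem pieceRes_naturality {F G : OModule X.toMonoidalSpace} (φ : F ⟶ G) {U V : X.AffineOpens}
    (h : V ≤ U) : F.pieceRes k h ≫ pieceMap k φ V = pieceMap k φ U ≫ G.pieceRes k h := by
  have h1 := tildeHom_naturality (X.linRes k h) _ _ _ _ (linSecMap_naturality k φ h)
  have h2 := congrArg (Scheme.Modules.pushforward (X.realizationι k U)).map h1
  rw [CategoryTheory.Functor.map_comp, CategoryTheory.Functor.map_comp] at h2
  unfold pieceRes pieceMap
  rw [Category.assoc, Category.assoc, ← NatTrans.naturality, ← NatTrans.naturality_assoc,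
    ← reassoc_of% h2]
  rfl

/-- The pairs `V ⊆ U` of affine open subsets of `X`. -/
abbrev AffinePairs (X : MonoidScheme.{u}) : Type u := {q : X.AffineOpens × X.AffineOpens // q.2 ≤ q.1}

/-- The realization `F_k`, a sheaf of modules on `X_k`, glued from the sheaves `k[F(U)]~` on the
open subschemes `Spec k[𝒪(U)]`, for `U ⊆ X` affine open: its sections over an open set `W` are the
families of sections of `k[F(U)]~` over `W ∩ Spec k[𝒪(U)]`, for all `U`, that are compatible under
the restriction maps for `V ⊆ U`. -/
abbrev realization (F : OModule X.toMonoidalSpace) : (X.realization k).Modules :=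
  equalizer
    (Pi.lift fun q : AffinePairs X => Pi.π (F.piece k) q.1.2)
    (Pi.lift fun q : AffinePairs X => Pi.π (F.piece k) q.1.1 ≫ F.pieceRes k q.2)

/-- The restriction of sections of `F_k` to `Spec k[𝒪(U)]`. -/
def realizationπ (F : OModule X.toMonoidalSpace) (U : X.AffineOpens) :
    F.realization k ⟶ F.piece k U :=
  equalizer.ι _ _ ≫ Pi.π (F.piece k) U

theorem realizationπ_res (F : OModule X.toMonoidalSpace) {U V : X.AffineOpens} (h : V ≤ U) :
    F.realizationπ k U ≫ F.pieceRes k h = F.realizationπ k V := by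
  have := congr($(equalizer.condition
    (Pi.lift fun q : AffinePairs X => Pi.π (F.piece k) q.1.2)
    (Pi.lift fun q : AffinePairs X => Pi.π (F.piece k) q.1.1 ≫ F.pieceRes k q.2)) ≫
      Pi.π _ (⟨(U, V), h⟩ : AffinePairs X))
  simp only [Category.assoc, Pi.lift_π] at this
  rw [realizationπ, Category.assoc, ← this]
  rfl

theorem realization_hom_ext (F : OModule X.toMonoidalSpace) {K : (X.realization k).Modules}
    {a b : K ⟶ F.realization k} (h : ∀ U, a ≫ F.realizationπ k U = b ≫ F.realizationπ k U) :
    a = b := by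
  refine equalizer.hom_ext (Pi.hom_ext _ _ fun U => ?_)
  simpa [realizationπ] using h U

/-- The morphism `F_k → G_k` induced by a morphism `F → G`. -/
def realizationMap {F G : OModule X.toMonoidalSpace} (φ : F ⟶ G) :
    F.realization k ⟶ G.realization k :=
  equalizer.lift (Pi.lift fun U => F.realizationπ k U ≫ pieceMap k φ U) (by
    refine Pi.hom_ext _ _ fun q => ?_
    simp only [Category.assoc, Pi.lift_π, Pi.lift_π_assoc]
    rw [← pieceRes_naturality, reassoc_of% F.realizationπ_res k q.2])

theorem realizationMap_π {F G : OModule X.toMonoidalSpace} (φ : F ⟶ G) (U : X.AffineOpens) :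
    realizationMap k φ ≫ G.realizationπ k U = F.realizationπ k U ≫ pieceMap k φ U := by
  conv_lhs => rw [realizationMap, realizationπ]
  rw [equalizer.lift_ι_assoc, Pi.lift_π]

/-- Realization, as a functor from `𝒪_X`-modules to `𝒪_{X_k}`-modules. -/
def realizationFunctor (X : MonoidScheme.{u}) :
    OModule X.toMonoidalSpace ⥤ (X.realization k).Modules where
  obj F := F.realization k
  map φ := realizationMap k φ
  map_id F := realization_hom_ext k _ fun U => by
    rw [realizationMap_π, pieceMap, linSecMap_id, tilde.map_id, CategoryTheory.Functor.map_id, Category.id_comp]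
    exact Category.comp_id _
  map_comp {F G H} φ ψ := realization_hom_ext k _ fun U => by
    rw [Category.assoc, realizationMap_π, realizationMap_π, reassoc_of% realizationMap_π k φ U]
    congr 1
    rw [pieceMap, linSecMap_comp, tilde.map_comp, CategoryTheory.Functor.map_comp]
    rfl

end OModule

/-- The extension of `F'_k` by `F_k` attached to an extension of `F'` by `F`: the sequence
`0 → F_k → G_k → F'_k → 0`, provided that realization preserves coherence (`hc`) and that this
sequence is a complex (`hz`) and is exact (`hs`). -/
def CohAlpha.Extension.realize {X : MonoidScheme.{u}} (k : Type u) [CommRing k]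
    {F' F : CohAlpha X} (E : CohAlpha.Extension F' F)
    (hc : ∀ G : CohAlpha X,
      isCoherentModule (X.realization k) ((OModule.realizationFunctor k X).obj G.obj))
    (hz : (OModule.realizationFunctor k X).map E.i.hom ≫
      (OModule.realizationFunctor k X).map E.p.hom = 0)
    (hs : (ShortComplex.mk _ _ hz).ShortExact) :
    Coh.Extension (Y := X.realization k) ⟨_, hc F'⟩ ⟨_, hc F⟩ where
  mid := ⟨_, hc E.mid⟩
  i := ObjectProperty.homMk ((OModule.realizationFunctor k X).map E.i.hom)
  p := ObjectProperty.homMk ((OModule.realizationFunctor k X).map E.p.hom)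
  zero := hz
  shortExact := hs

end

/-! Everything reduces to sections over affine open sets. A nonempty affine monoid scheme `MSpec A`
has a closed point, the ideal of non-units, whose only open neighbourhood in `MSpec A` is the whole
space. Hence an affine open set `U` with nontrivial `𝒪(U)` is the smallest neighbourhood of some
point `x` (`AffineChart.exists_point`), the stalk of a sheaf at `x` is its set of sections over `U`,
and all stalkwise conditions (type `α`, admissible exactness) become conditions on sections over
`U`.

For coherent `F`, linearization commutes with localization, so the sheaves `k[F(U)]~` agree on
overlaps and `F_k` restricts to `k[F(U)]~` on `Spec k[𝒪(U)]` (`existsUnique_compatible_family`,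
`realizationπ_bijective`). Coherence follows. For exactness, an admissible sequence `F ↪ G ↠ F'`
gives on `U` a decomposition of `G(U)` into `F(U)` and a copy of `F'(U) \ {0}`, because the
projection is injective outside the preimage of `0`. So the linearized sequence is split exact over
`k` (`Lin.map_exact`), and exactness passes to the sheaves on a basis of open sets
(`shortExact_of_basis`).

For injectivity, take two extensions with middle terms `G₁`, `G₂`. The decomposition above gives a
canonical bijection between `G₁(U)` and `G₂(U)`, expressed by the relation `Rel`, with no reference
to the linear isomorphism `ε` of the realizations. What `ε` must supply is compatibility with the
action of `A = 𝒪(U)`. The only doubtful case is that of partners `s`, `t` outside the kernels of the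
projections with `a • s = i₁ v₁` and `a • t = i₂ v₂` inside them; it must be shown that `v₁ = v₂`.
On `U`, `ε` is a `k[A]`-linear map `e`, and `e s - t` dies in `k[F'(U)]`, so it is `i₂ δ` for some
`δ` in `k[F(U)]`; multiplying by `a` gives `a • δ = v₁ - v₂`. If `v₁ ≠ v₂`, one of them is non-zero
and occurs in `a • δ`, hence is of the form `a • v`. Then `a • s = a • i₁ v` (or likewise for `t`),
and type `α` forces either `s = i₁ v`, impossible outside the kernel, or `a • s = 0`, contradicting
that the element is non-zero. This is `Rel.smul`. Compatibility with restriction then follows by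
localization (`Rel.res`), and the bijections glue to an equivalence of extensions
(`equiv_of_rel_smul`). -/

noncomputable section

/-! ### Sections of sheaves of modules on schemes -/

namespace AlgebraicGeometry.Scheme.Modules

variable {Y Z : Scheme.{u}}

/-- Restriction of sections of a sheaf of modules. -/
def rest (P : Y.Modules) {V U : Y.Opens} (h : V ≤ U) (s : Γ(P, U)) : Γ(P, V) :=
  P.presheaf.map (homOfLE h).op s

theorem rest_rest (P : Y.Modules) {W V U : Y.Opens} (h : V ≤ U) (h' : W ≤ V) (s : Γ(P, U)) :
    P.rest h' (P.rest h s) = P.rest (h'.trans h) s := by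
  change P.presheaf.map _ (P.presheaf.map _ s) = P.presheaf.map _ s
  rw [← ConcreteCategory.comp_apply, ← Functor.map_comp]
  rfl

theorem rest_refl (P : Y.Modules) {U : Y.Opens} (s : Γ(P, U)) : P.rest le_rfl s = s := by
  change P.presheaf.map (𝟙 _) s = s
  rw [P.presheaf.map_id]
  rfl

theorem app_rest {P Q : Y.Modules} (φ : P ⟶ Q) {V U : Y.Opens} (h : V ≤ U) (s : Γ(P, U)) :
    φ.app V (P.rest h s) = Q.rest h (φ.app U s) :=
  congr($(φ.mapPresheaf.naturality (homOfLE h).op) s)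

theorem rest_bijective_of_eq (P : Y.Modules) {V U : Y.Opens} (h : V = U) :
    Function.Bijective (P.rest h.le) := by
  subst h
  rw [show P.rest (le_refl V) = id from funext P.rest_refl]
  exact Function.bijective_id

theorem eq_of_rest_eq (P : Y.Modules) {ι : Type u} {U : ι → Y.Opens} {V : Y.Opens}
    (hU : ∀ i, U i ≤ V) (hV : V ≤ iSup U) {s t : Γ(P, V)}
    (h : ∀ i, P.rest (hU i) s = P.rest (hU i) t) : s = t :=
  TopCat.Sheaf.eq_of_locally_eq' ⟨P.presheaf, P.isSheaf⟩ U V (fun i => homOfLE (hU i)) hV s t h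

theorem exists_rest_eq (P : Y.Modules) {ι : Type u} {U : ι → Y.Opens} {V : Y.Opens}
    (hU : ∀ i, U i ≤ V) (hV : V ≤ iSup U) (s : ∀ i, Γ(P, U i))
    (h : ∀ i j, P.rest inf_le_left (s i) = P.rest (V := U i ⊓ U j) inf_le_right (s j)) :
    ∃ t : Γ(P, V), ∀ i, P.rest (hU i) t = s i :=
  (TopCat.Sheaf.existsUnique_gluing' ⟨P.presheaf, P.isSheaf⟩ U V (fun i => homOfLE (hU i)) hV s
    h).exists

/-! ### Gluing sheaves along a directed family of open sets -/

section Directed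

variable {I : Type u} [Preorder I] (O : I → Y.Opens) (P : I → Y.Modules)
  (r : ∀ {i j : I}, j ≤ i → (P i ⟶ P j))

/-- In a system of sheaves `P i` supported on members `O i` of a directed family of open sets,
with isomorphisms `P i → P j` over `O j`, a section of `P i` over a subset of `O i` extends to
a unique compatible family. -/
theorem existsUnique_extension
    (hr : ∀ {i j l : I} (h : j ≤ i) (h' : l ≤ j), r h ≫ r h' = r (h'.trans h))
    (hO : ∀ {i j : I}, j ≤ i → O j ≤ O i)
    (hP : ∀ i W, Function.Bijective ((P i).rest (inf_le_left : W ⊓ O i ≤ W)))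
    (hiso : ∀ {i j : I} (h : j ≤ i) (W : Y.Opens), W ≤ O j → Function.Bijective ((r h).app W))
    (hdir : ∀ i j x, x ∈ O i → x ∈ O j → ∃ l, l ≤ i ∧ l ≤ j ∧ x ∈ O l)
    {i : I} {W : Y.Opens} (hW : W ≤ O i) (s : Γ(P i, W)) (j : I) :
    ∃! t : Γ(P j, W), ∀ l (hi : l ≤ i) (hj : l ≤ j), (r hj).app W t = (r hi).app W s := by
  have hr' : ∀ {i j l : I} (h : j ≤ i) (h' : l ≤ j) (V : Y.Opens) (x : Γ(P i, V)),
      (r h').app V ((r h).app V x) = (r (h'.trans h)).app V x := by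
    intro i j l h h' V x
    rw [← hr h h']
    rfl
  let L := {l : I // l ≤ i ∧ l ≤ j}
  have hcov : W ⊓ O j ≤ ⨆ l : L, W ⊓ O l.1 := by
    rintro x ⟨hxW, hxj⟩
    obtain ⟨l, hli, hlj, hxl⟩ := hdir i j x (hW hxW) hxj
    exact Opens.mem_iSup.mpr ⟨⟨l, hli, hlj⟩, hxW, hxl⟩
  have hle : ∀ l : L, W ⊓ O l.1 ≤ W ⊓ O j := fun l => inf_le_inf_left _ (hO l.2.2)
  refine existsUnique_of_exists_of_unique ?_ ?_
  -- Over `W ⊓ O l` the map `P j → P l` is invertible, so `s`, pushed to `P l`, can be pulled back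
  -- to `P j`.
  · choose u hu using fun l : L => (hiso l.2.2 (W ⊓ O l.1) inf_le_right).2
      ((P l.1).rest inf_le_left ((r l.2.1).app W s))
    have hres : ∀ (l m : L) (hml : m.1 ≤ l.1) (h : W ⊓ O m.1 ≤ W ⊓ O l.1),
        (P j).rest h (u l) = u m := by
      intro l m hml h
      apply (hiso m.2.2 (W ⊓ O m.1) inf_le_right).1
      rw [hu, app_rest, ← hr' l.2.2 hml, hu, app_rest, rest_rest, hr']
    -- The overlap of two members of the cover is itself covered by the `W ⊓ O m` with `m` below
    -- both indices, where both local sections restrict to `u m`.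
    obtain ⟨t₀, ht₀⟩ := (P j).exists_rest_eq hle hcov u (by
      intro l l'
      refine (P j).eq_of_rest_eq (ι := {m : I // m ≤ l.1 ∧ m ≤ l'.1}) (U := fun m => W ⊓ O m.1)
        (fun m => le_inf (inf_le_inf_left _ (hO m.2.1)) (inf_le_inf_left _ (hO m.2.2))) ?_ ?_
      · rintro x ⟨⟨hxW, hxl⟩, -, hxl'⟩
        obtain ⟨m, hml, hml', hxm⟩ := hdir _ _ x hxl hxl'
        exact Opens.mem_iSup.mpr ⟨⟨m, hml, hml'⟩, hxW, hxm⟩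
      · rintro ⟨m, hm, hm'⟩
        rw [rest_rest, rest_rest, hres l ⟨m, hm.trans l.2.1, hm.trans l.2.2⟩ hm,
          hres l' ⟨m, hm.trans l.2.1, hm.trans l.2.2⟩ hm'])
    -- Since `P j` is supported on `O j`, the section over `W ⊓ O j` is the restriction of a section
    -- over `W`.
    obtain ⟨t, rfl⟩ := (hP j W).2 t₀
    refine ⟨t, fun l hi hj => (hP l W).1 ?_⟩
    rw [← app_rest, ← hu ⟨l, hi, hj⟩, ← ht₀ ⟨l, hi, hj⟩, rest_rest]
  · intro t t' ht ht'
    apply (hP j W).1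
    refine (P j).eq_of_rest_eq hle hcov fun l => (hiso l.2.2 _ inf_le_right).1 ?_
    rw [rest_rest, rest_rest, app_rest, app_rest, ht l.1 l.2.1, ht' l.1 l.2.1]

/-- Each member of the family is the extension of `s` to that index. Compatibility is automatic: the
image in `P l` of the extension to `j` has the property that characterizes the extension to `l`.
Compatible families are the sections of the glued sheaf, so this identifies the latter with `P i`
over `O i`. -/
theorem existsUnique_compatible_family
    (hr : ∀ {i j l : I} (h : j ≤ i) (h' : l ≤ j), r h ≫ r h' = r (h'.trans h))
    (hO : ∀ {i j : I}, j ≤ i → O j ≤ O i)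
    (hP : ∀ i W, Function.Bijective ((P i).rest (inf_le_left : W ⊓ O i ≤ W)))
    (hiso : ∀ {i j : I} (h : j ≤ i) (W : Y.Opens), W ≤ O j → Function.Bijective ((r h).app W))
    (hdir : ∀ i j x, x ∈ O i → x ∈ O j → ∃ l, l ≤ i ∧ l ≤ j ∧ x ∈ O l)
    {i : I} {W : Y.Opens} (hW : W ≤ O i) (s : Γ(P i, W)) :
    ∃! t : ∀ j, Γ(P j, W), t i = s ∧ ∀ {j l : I} (h : l ≤ j), (r h).app W (t j) = t l := by
  have hr' : ∀ {i j l : I} (h : j ≤ i) (h' : l ≤ j) (V : Y.Opens) (x : Γ(P i, V)),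
      (r h').app V ((r h).app V x) = (r (h'.trans h)).app V x := by
    intro i j l h h' V x
    rw [← hr h h']
    rfl
  have key := existsUnique_extension O P r hr hO hP hiso hdir hW s
  choose t ht htu using key
  refine ⟨t, ⟨?_, ?_⟩, ?_⟩
  · exact (htu i s fun l hi hj => rfl).symm
  · intro j l h
    refine htu l _ fun m hi hm => ?_
    rw [hr']
    exact ht j m hi _
  · rintro t' ⟨rfl, h'⟩
    funext j
    exact htu j _ fun l hi hj => by rw [h', h']

end Directed

/-! ### Restriction along an open immersion -/

section Restrict

variable (j : Z ⟶ Y) [IsOpenImmersion j]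

/-- A direct image only sees the part of `W` inside the image of `j`, as both open sets have the
same preimage. -/
theorem rest_pushforward_bijective (K : Z.Modules) (W : Y.Opens) :
    Function.Bijective
      (((pushforward j).obj K).rest (inf_le_left : W ⊓ j.opensRange ≤ W)) := by
  have h : j ⁻¹ᵁ (W ⊓ j.opensRange) = j ⁻¹ᵁ W := by
    ext x
    simp
  exact K.rest_bijective_of_eq h

/-- The morphism `M|_Z → N` attached to a morphism `M → j_* N`, where `j : Z → Y` is an open
immersion. -/
def restrictHom {M : Y.Modules} {N : Z.Modules} (φ : M ⟶ (pushforward j).obj N) :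
    M.restrict j ⟶ N :=
  ((restrictAdjunction j).homEquiv M N).symm φ

theorem restrictHom_app {M : Y.Modules} {N : Z.Modules} (φ : M ⟶ (pushforward j).obj N)
    (V : Z.Opens) (s : Γ(M, j ''ᵁ V)) :
    (restrictHom j φ).app V s = N.rest (j.preimage_image_eq V).ge (φ.app (j ''ᵁ V) s) := by
  rw [restrictHom, Adjunction.homEquiv_counit]
  rfl

/-- Taking images under `j` identifies the open subsets of `Z` with those of `Y` inside the range of
`j`, and an isomorphism of sheaves can be tested on sections. -/
theorem isIso_restrictHom_iff {M : Y.Modules} {N : Z.Modules} (φ : M ⟶ (pushforward j).obj N) :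
    IsIso (restrictHom j φ) ↔
      ∀ W : Y.Opens, W ≤ j.opensRange → Function.Bijective (φ.app W) := by
  have h : ∀ V : Z.Opens, Function.Bijective ((restrictHom j φ).app V) ↔
      Function.Bijective (φ.app (j ''ᵁ V)) := by
    intro V
    have h1 : ⇑((restrictHom j φ).app V) = N.rest (j.preimage_image_eq V).ge ∘
        (φ.app (j ''ᵁ V) : Γ(M, j ''ᵁ V) → Γ(N, j ⁻¹ᵁ j ''ᵁ V)) :=
      funext fun s => restrictHom_app j φ V s
    rw [h1]
    exact (N.rest_bijective_of_eq (j.preimage_image_eq V).symm).of_comp_iff' _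
  rw [Hom.isIso_iff_isIso_app]
  simp only [ConcreteCategory.isIso_iff_bijective]
  constructor
  · intro H W hW
    have h2 : j ''ᵁ j ⁻¹ᵁ W = W := by
      rw [j.image_preimage_eq_opensRange_inf, inf_eq_right.mpr hW]
    rw [← h2]
    exact (h _).mp (H _)
  · intro H V
    exact (h V).mpr (H _ (j.image_le_opensRange V))

theorem restrictHom_naturality {M M' : Y.Modules} {N N' : Z.Modules}
    {φ : M ⟶ (pushforward j).obj N} {φ' : M' ⟶ (pushforward j).obj N'} {a : M ⟶ M'} {b : N ⟶ N'}
    (h : φ ≫ (pushforward j).map b = a ≫ φ') :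
    restrictHom j φ ≫ b = (restrictFunctor j).map a ≫ restrictHom j φ' := by
  rw [restrictHom, restrictHom, ← Adjunction.homEquiv_naturality_right_symm, h,
    Adjunction.homEquiv_naturality_left_symm]

end Restrict

end AlgebraicGeometry.Scheme.Modules

/-! ### Morphisms out of `M~` -/

section Tilde

open Scheme.Modules

variable {R S T : CommRingCat.{u}} (r : R ⟶ S)

/-- The section of `M~` over `U` attached to an element of `M`. -/
def tildeSection {M : ModuleCat.{u} R} (U : (Spec R).Opens) (m : M) : Γ(tilde M, U) :=
  (tilde.toOpen M U).hom m

theorem rest_tildeSection {M : ModuleCat.{u} R} {U V : (Spec R).Opens} (h : V ≤ U) (m : M) :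
    (tilde M).rest h (tildeSection U m) = tildeSection V m := rfl

theorem tildeSection_smul {M : ModuleCat.{u} R} (U : (Spec R).Opens) (a : R) (m : M) :
    tildeSection U (a • m) = a • tildeSection U m :=
  (tilde.toOpen M U).hom.map_smul a m

/-- The equation is a hypothesis because the result is applied to preimages, which are only
propositionally the whole space. -/
theorem tildeSection_bijective {M : ModuleCat.{u} R} {U : (Spec R).Opens} (hU : U = ⊤) :
    Function.Bijective (tildeSection (M := M) U) := by
  subst hU
  exact ConcreteCategory.bijective_of_isIso (tilde.toOpen M ⊤)

/-- This is the adjunction between `M ↦ M~` and global sections. -/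
theorem tilde_hom_ext {M : ModuleCat.{u} R} {K : (Spec R).Modules} {φ ψ : tilde M ⟶ K}
    (h : ∀ m : M, φ.app ⊤ (tildeSection ⊤ m) = ψ.app ⊤ (tildeSection ⊤ m)) : φ = ψ := by
  apply (tilde.adjunction.homEquiv M K).injective
  refine (Adjunction.homEquiv_unit ..).trans (Eq.trans ?_ (Adjunction.homEquiv_unit ..).symm)
  ext m
  exact h m

theorem tilde_map_app {M N : ModuleCat.{u} R} (f : M ⟶ N) (U : (Spec R).Opens) (m : M) :
    (tilde.map f).app U (tildeSection U m) = tildeSection U (f.hom m) :=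
  congr($(tilde.toOpen_map_app f U).hom m)

variable {M : ModuleCat.{u} R} {N : ModuleCat.{u} S}
  (g : M ⟶ (ModuleCat.restrictScalars r.hom).obj N)

/-- The section of the direct image of `N~` over `U` attached to an element of `N`. -/
def tildePushSection (U : (Spec R).Opens) (n : N) :
    Γ((pushforward (Spec.map r)).obj (tilde N), U) :=
  tildeSection (Spec.map r ⁻¹ᵁ U) n

theorem tildePushSection_smul (U : (Spec R).Opens) (a : R) (n : N) :
    tildePushSection r U (r.hom a • n) = a • tildePushSection r U n :=
  (tildeSection_smul (Spec.map r ⁻¹ᵁ U) (r.hom a) n).trans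
    ((((pushforwardCompModulesSpecToSheafIso r).inv.app (tilde N)).hom.app (op U)).hom.map_smul a
      (tildeSection (Spec.map r ⁻¹ᵁ U) n))

theorem tildePushSection_zero (U : (Spec R).Opens) : tildePushSection r U (0 : N) = 0 :=
  (tilde.toOpen N (Spec.map r ⁻¹ᵁ U)).hom.map_zero

/-- On global sections this is the adjunction that defines `tildeHom`; sections coming from `M` over
smaller open sets are restrictions of global ones. -/
theorem tildeHom_app (U : (Spec R).Opens) (m : M) :
    (tildeHom r g).app U (tildeSection U m) = tildePushSection r U (g.hom m : N) := by
  have h : (tildeHom r g).app ⊤ (tildeSection ⊤ m) = tildePushSection r ⊤ (g.hom m : N) := by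
    have h : tilde.adjunction.homEquiv M _ (tildeHom r g) = _ := Equiv.apply_symm_apply _ _
    have h' := (Adjunction.homEquiv_unit ..).symm.trans h
    exact congr($(h').hom m)
  rw [← rest_tildeSection le_top m, app_rest]
  exact congrArg _ h

theorem app_smul_Spec {K L : (Spec R).Modules} (φ : K ⟶ L) (U : (Spec R).Opens) (a : R)
    (x : Γ(K, U)) : φ.app U (a • x) = a • φ.app U x :=
  ((modulesSpecToSheaf.map φ).hom.app (op U)).hom.map_smul a x

/-- The sections of a quasi-coherent sheaf over `D(f)` are the localization of its global sections
at `f`. -/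
theorem isIso_of_bijective_app_top {K L : (Spec R).Modules} [K.IsQuasicoherent]
    [L.IsQuasicoherent] (φ : K ⟶ L) (h : Function.Bijective (φ.app ⊤)) : IsIso φ := by
  rw [← isIso_iff_of_reflects_iso _ (modulesSpecToSheaf (R := R))]
  refine isLocalizing_of_isIso_app_top ?_
    ((isIso_fromTildeΓ_iff_isLocalizing K).mp inferInstance)
    ((isIso_fromTildeΓ_iff_isLocalizing L).mp inferInstance)
  exact (ConcreteCategory.isIso_iff_bijective _).mpr h

/-! ### Sections of `M~` over `D(f)`: clearing denominators -/

section BasicOpen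

variable (f : R) {D : (Spec R).Opens}

theorem exists_smul_eq_tildeSection (hD : D = PrimeSpectrum.basicOpen f) {M : ModuleCat.{u} R}
    (x : Γ(tilde M, D)) : ∃ (n : ℕ) (m : M), f ^ n • x = tildeSection D m := by
  subst hD
  obtain ⟨n, m, h⟩ := IsLocalizedModule.Away.surj (tilde.toOpen M _).hom f x
  exact ⟨n, m, h⟩

theorem exists_smul_eq_zero_of_tildeSection (hD : D = PrimeSpectrum.basicOpen f)
    {M : ModuleCat.{u} R} {m : M} (h : tildeSection D m = 0) : ∃ n : ℕ, f ^ n • m = 0 := by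
  subst hD
  obtain ⟨⟨_, n, rfl⟩, hn⟩ := (IsLocalizedModule.eq_zero_iff (.powers f)
    (tilde.toOpen M (PrimeSpectrum.basicOpen f)).hom).mp h
  exact ⟨n, hn⟩

theorem isSMulRegular_basicOpen (hD : D = PrimeSpectrum.basicOpen f) (K : (Spec R).Modules)
    (n : ℕ) : IsSMulRegular Γ(K, D) (f ^ n) :=
  (isSMulRegular_of_le_basicOpen hD.le).pow n

theorem exists_smul_eq_basicOpen (hD : D = PrimeSpectrum.basicOpen f) (K : (Spec R).Modules)
    (n : ℕ) (y : Γ(K, D)) : ∃ x : Γ(K, D), f ^ n • x = y := by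
  obtain ⟨x, hx⟩ := ((Module.End.isUnit_iff _).mp
    ((isUnit_algebraMap_end_of_le_basicOpen (M := K) f hD.le).pow n)).2 y
  rw [← map_pow] at hx
  exact ⟨x, hx⟩

end BasicOpen

/-- If `N` is the localization of `M` at `f` and `D(f)` contains the image of `Spec S → Spec R`,
then `M~` and the direct image of `N~` have the same sections over `D(f)`. -/
theorem tildeHom_app_bijective (f : R) {D : (Spec R).Opens} (hD : D = PrimeSpectrum.basicOpen f)
    (hDtop : Spec.map r ⁻¹ᵁ D = ⊤)
    (hsurj : ∀ n : N, ∃ (k : ℕ) (m : M), r.hom f ^ k • n = g.hom m)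
    (hker : ∀ m : M, g.hom m = (0 : N) → ∃ k : ℕ, f ^ k • m = 0) :
    Function.Bijective ((tildeHom r g).app D) := by
  constructor
  · rw [injective_iff_map_eq_zero]
    intro x hx
    obtain ⟨n, m, hm⟩ := exists_smul_eq_tildeSection f hD x
    have h2 := congrArg ((tildeHom r g).app D) hm
    rw [tildeHom_app, app_smul_Spec, hx, smul_zero] at h2
    have h3 : g.hom m = (0 : N) := by
      apply (tildeSection_bijective hDtop).1
      exact h2.symm.trans (tildePushSection_zero r D).symm
    obtain ⟨k, hk⟩ := hker m h3
    apply isSMulRegular_basicOpen f hD (tilde M) n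
    apply isSMulRegular_basicOpen f hD (tilde M) k
    change f ^ k • f ^ n • x = f ^ k • f ^ n • 0
    rw [hm, ← tildeSection_smul, hk, smul_zero, smul_zero]
    exact (tilde.toOpen M D).hom.map_zero
  · intro y
    -- As the preimage of `D` is all of `Spec S`, sections of the direct image over `D` are elements
    -- of `N`.
    obtain ⟨n, hn⟩ := (tildeSection_bijective (M := N) hDtop).2 y
    have hn' : tildePushSection r D n = y := hn
    obtain ⟨k, m, hm⟩ := hsurj n
    obtain ⟨x, hx⟩ := exists_smul_eq_basicOpen f hD (tilde M) k (tildeSection D m)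
    refine ⟨x, isSMulRegular_basicOpen f hD ((pushforward (Spec.map r)).obj (tilde N)) k ?_⟩
    change f ^ k • _ = f ^ k • _
    rw [← hn', ← tildePushSection_smul, map_pow, hm, ← app_smul_Spec, hx, tildeHom_app]

/-- If `N` is the localization of `M` at `f` and `Spec S → Spec R` is the open immersion with
image `D(f)`, then the restriction of `M~` to `Spec S` is `N~`. -/
theorem isIso_restrictHom_tildeHom [IsOpenImmersion (Spec.map r)] (f : R)
    (hf : (Spec.map r).opensRange = PrimeSpectrum.basicOpen f)
    (hsurj : ∀ n : N, ∃ (k : ℕ) (m : M), r.hom f ^ k • n = g.hom m)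
    (hker : ∀ m : M, g.hom m = (0 : N) → ∃ k : ℕ, f ^ k • m = 0) :
    IsIso (restrictHom (Spec.map r) (tildeHom r g)) := by
  -- Both sheaves on `Spec S` are quasi-coherent, so global sections suffice; for the restriction of
  -- `M~` these are the sections over `D(f)`.
  apply isIso_of_bijective_app_top
  have h1 : ⇑((restrictHom (Spec.map r) (tildeHom r g)).app ⊤) =
      (tilde N).rest ((Spec.map r).preimage_image_eq ⊤).ge ∘
        ((tildeHom r g).app (Spec.map r ''ᵁ ⊤) :
          Γ(tilde M, Spec.map r ''ᵁ ⊤) → Γ(tilde N, Spec.map r ⁻¹ᵁ Spec.map r ''ᵁ ⊤)) :=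
    funext fun s => restrictHom_app _ _ _ s
  rw [h1]
  refine (((tilde N).rest_bijective_of_eq
    ((Spec.map r).preimage_image_eq ⊤).symm).of_comp_iff' _).mpr ?_
  exact tildeHom_app_bijective r g f ((Spec.map r).image_top_eq_opensRange.trans hf)
    ((Spec.map r).preimage_image_eq ⊤) hsurj hker

/-- `tildeHom` is compatible with compositions. -/
theorem tildeHom_comp {r : R ⟶ S} {r' : S ⟶ T} {r'' : R ⟶ T} {P : ModuleCat.{u} T}
    (hr : Spec.map r' ≫ Spec.map r = Spec.map r'')
    (g : M ⟶ (ModuleCat.restrictScalars r.hom).obj N)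
    (g' : N ⟶ (ModuleCat.restrictScalars r'.hom).obj P)
    (g'' : M ⟶ (ModuleCat.restrictScalars r''.hom).obj P)
    (h : ∀ m : M, (g''.hom m : P) = g'.hom (g.hom m : N)) :
    tildeHom r g ≫ (pushforward (Spec.map r)).map (tildeHom r' g') ≫
      (pushforwardComp (Spec.map r') (Spec.map r)).hom.app _ ≫
      (pushforwardCongr hr).hom.app _ =
    tildeHom r'' g'' := by
  apply tilde_hom_ext
  intro m
  rw [tildeHom_app, h, Hom.comp_app, ConcreteCategory.comp_apply, tildeHom_app,
    Hom.comp_app, ConcreteCategory.comp_apply, Hom.comp_app, ConcreteCategory.comp_apply,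
    pushforwardCongr_hom_app_app, pushforwardComp_hom_app_app]
  refine (congrArg _ (tildeHom_app r' g' _ (g.hom m : N))).trans ?_
  generalize (g'.hom (g.hom m : N) : P) = p
  exact rest_tildeSection (M := P) (U := Spec.map r' ⁻¹ᵁ Spec.map r ⁻¹ᵁ ⊤)
    (V := Spec.map r'' ⁻¹ᵁ ⊤) (by rw [← hr]; rfl) p


/-! ### Exactness of `M ↦ M~` on sections over `D(f)` -/

section Exact

variable {M₁ M₂ M₃ : ModuleCat.{u} R} (i : M₁ ⟶ M₂) (p : M₂ ⟶ M₃) (f : R)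
  {D : (Spec R).Opens}

theorem tilde_map_app_injective (hD : D = PrimeSpectrum.basicOpen f)
    (hi : Function.Injective i.hom) : Function.Injective ((tilde.map i).app D) := by
  rw [injective_iff_map_eq_zero]
  intro x hx
  obtain ⟨n, m, hm⟩ := exists_smul_eq_tildeSection f hD x
  have h2 := congrArg ((tilde.map i).app D) hm
  rw [app_smul_Spec, hx, smul_zero, tilde_map_app] at h2
  obtain ⟨k, hk⟩ := exists_smul_eq_zero_of_tildeSection f hD h2.symm
  rw [← i.hom.map_smul, ← i.hom.map_zero] at hk
  apply isSMulRegular_basicOpen f hD _ n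
  apply isSMulRegular_basicOpen f hD _ k
  change f ^ k • f ^ n • x = f ^ k • f ^ n • 0
  rw [hm, ← tildeSection_smul, hi hk, smul_zero, smul_zero]
  exact (tilde.toOpen M₁ D).hom.map_zero

theorem tilde_map_app_surjective (hD : D = PrimeSpectrum.basicOpen f)
    (hp : Function.Surjective p.hom) : Function.Surjective ((tilde.map p).app D) := by
  intro y
  obtain ⟨n, m, hm⟩ := exists_smul_eq_tildeSection f hD y
  obtain ⟨m', rfl⟩ := hp m
  obtain ⟨x, hx⟩ := exists_smul_eq_basicOpen f hD _ n (tildeSection (M := M₂) D m')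
  refine ⟨x, isSMulRegular_basicOpen f hD _ n ?_⟩
  change f ^ n • _ = f ^ n • _
  rw [← app_smul_Spec, hx, tilde_map_app, hm]

theorem tilde_map_app_exact (hD : D = PrimeSpectrum.basicOpen f)
    (hip : ∀ m : M₂, p.hom m = 0 → ∃ m', i.hom m' = m) (x : Γ(tilde M₂, D))
    (hx : (tilde.map p).app D x = 0) : ∃ y, (tilde.map i).app D y = x := by
  obtain ⟨n, m, hm⟩ := exists_smul_eq_tildeSection f hD x
  have h2 := congrArg ((tilde.map p).app D) hm
  rw [app_smul_Spec, hx, smul_zero, tilde_map_app] at h2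
  obtain ⟨k, hk⟩ := exists_smul_eq_zero_of_tildeSection f hD h2.symm
  rw [← p.hom.map_smul] at hk
  obtain ⟨m', hm'⟩ := hip _ hk
  -- The factor `f ^ n` clears the denominator of `x`, and the further `f ^ k` moves the numerator
  -- into the kernel of `p`.
  obtain ⟨y, hy⟩ := exists_smul_eq_basicOpen f hD _ (k + n) (tildeSection (M := M₁) D m')
  refine ⟨y, isSMulRegular_basicOpen f hD _ (k + n) ?_⟩
  change f ^ (k + n) • _ = f ^ (k + n) • _
  rw [← app_smul_Spec, hy, tilde_map_app, hm', tildeSection_smul, ← hm, pow_add, mul_smul]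

end Exact

end Tilde

/-! ### Exactness and limits of sheaves of modules in terms of sections -/

namespace AlgebraicGeometry.Scheme.Modules

variable {Y : Scheme.{u}}

theorem rest_zero (P : Y.Modules) {V U : Y.Opens} (h : V ≤ U) : P.rest h (0 : Γ(P, U)) = 0 :=
  (P.presheaf.map (homOfLE h).op).hom.map_zero

/-- Sections over `W`, as a functor to types. -/
def sectionsFunctor (W : Y.Opens) : Y.Modules ⥤ Type u :=
  toPresheaf Y ⋙ (CategoryTheory.evaluation _ _).obj (op W) ⋙ CategoryTheory.forget Ab.{u}

instance (W : Y.Opens) : PreservesLimits (sectionsFunctor W) :=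
  have : PreservesLimits ((CategoryTheory.evaluation (Y.Opens)ᵒᵖ Ab.{u}).obj (op W) ⋙
    CategoryTheory.forget Ab.{u}) := comp_preservesLimits _ _
  comp_preservesLimits (toPresheaf Y) _

theorem app_injective_of_mono {P Q : Y.Modules} (φ : P ⟶ Q) [Mono φ] (W : Y.Opens) :
    Function.Injective (φ.app W) :=
  (mono_iff_injective ((sectionsFunctor W).map φ)).mp inferInstance

/-- A family of sections of the factors of a product comes from a section of the product. -/
theorem exists_pi_section {I : Type u} (P : I → Y.Modules) (W : Y.Opens) (s : ∀ i, Γ(P i, W)) :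
    ∃ t : Γ(∏ᶜ P, W), ∀ i, (Pi.π P i).app W t = s i := by
  have hl := isLimitOfPreserves (sectionsFunctor W) (limit.isLimit (Discrete.functor P))
  obtain ⟨t, ht, -⟩ := (Types.isLimit_iff _).mp ⟨hl⟩ (fun i => s i.as) (by
    rintro ⟨i⟩ ⟨j⟩ ⟨⟨h⟩⟩
    cases h
    exact ConcreteCategory.congr_hom ((Discrete.functor P ⋙ sectionsFunctor W).map_id ⟨i⟩) (s i))
  exact ⟨t, fun i => ht ⟨i⟩⟩

theorem pi_section_ext {I : Type u} (P : I → Y.Modules) (W : Y.Opens) {s t : Γ(∏ᶜ P, W)}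
    (h : ∀ i, (Pi.π P i).app W s = (Pi.π P i).app W t) : s = t := by
  have hl := isLimitOfPreserves (sectionsFunctor W) (limit.isLimit (Discrete.functor P))
  exact Concrete.isLimit_ext _ hl s t fun i => h i.as

/-- A section on which two morphisms agree comes from their equalizer. -/
theorem exists_equalizer_section {P Q : Y.Modules} (a b : P ⟶ Q) (W : Y.Opens) (s : Γ(P, W))
    (h : a.app W s = b.app W s) : ∃ t : Γ(equalizer a b, W), (equalizer.ι a b).app W t = s := by
  have hl := isLimitForkMapOfIsLimit (sectionsFunctor W) _ (equalizerIsEqualizer a b)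
  obtain ⟨t, ht, -⟩ := (Types.type_equalizer_iff_unique _ _).mp ⟨hl⟩ s h
  exact ⟨t, ht⟩

theorem mono_of_app_injective {P Q : Y.Modules} (φ : P ⟶ Q)
    (h : ∀ W (s : Γ(P, W)), φ.app W s = 0 → s = 0) : Mono φ := by
  refine Preadditive.mono_of_cancel_zero _ fun {K} a ha => ?_
  ext W x
  refine h W _ ?_
  exact congr(($ha).app W x)

theorem epi_of_locally_surjective {P Q : Y.Modules} (φ : P ⟶ Q)
    (h : ∀ W (s : Γ(Q, W)), ∀ x ∈ W, ∃ (V : Y.Opens) (hV : V ≤ W) (t : Γ(P, V)),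
      x ∈ V ∧ φ.app V t = Q.rest hV s) : Epi φ := by
  refine Preadditive.epi_of_cancel_zero _ fun {K} a ha => ?_
  ext W s
  choose V hV t hx ht using h W s
  refine K.eq_of_rest_eq (ι := W) (U := fun x => V x.1 x.2) (fun x => hV _ _) (fun x hxW =>
    Opens.mem_iSup.mpr ⟨⟨x, hxW⟩, hx x hxW⟩) fun x => ?_
  rw [← app_rest, ← ht]
  refine Eq.trans ?_ (K.rest_zero _).symm
  exact congr(($ha).app _ (t x.1 x.2))

/-- A sequence of sheaves of modules is exact if sections over the members of a basis of open sets
form exact sequences. -/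
theorem shortExact_of_basis {S : ShortComplex Y.Modules} (B : Set Y.Opens)
    (hB : Opens.IsBasis B)
    (hf : ∀ W ∈ B, Function.Injective (S.f.app W))
    (hfg : ∀ W ∈ B, ∀ s : Γ(S.X₂, W), S.g.app W s = 0 → ∃ t, S.f.app W t = s)
    (hg : ∀ W ∈ B, Function.Surjective (S.g.app W)) : S.ShortExact := by
  have hB' : ∀ (W : Y.Opens), ∀ x ∈ W, ∃ V ∈ B, V ≤ W ∧ x ∈ V := by
    intro W x hx
    obtain ⟨V, hV, hxV, hVW⟩ := Opens.isBasis_iff_nbhd.mp hB hx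
    exact ⟨V, hV, hVW, hxV⟩
  have hmono : Mono S.f := by
    refine mono_of_app_injective _ fun W s hs => ?_
    choose V hV hVW hx using hB' W
    refine S.X₁.eq_of_rest_eq (ι := W) (U := fun x => V x.1 x.2) (fun x => hVW _ _)
      (fun x hxW => Opens.mem_iSup.mpr ⟨⟨x, hxW⟩, hx x hxW⟩) fun x => hf _ (hV _ _) ?_
    rw [app_rest, hs, app_rest, map_zero, rest_zero]
  have hepi : Epi S.g := by
    refine epi_of_locally_surjective _ fun W s x hx => ?_
    obtain ⟨V, hV, hVW, hxV⟩ := hB' W x hx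
    obtain ⟨t, ht⟩ := hg V hV (S.X₃.rest hVW s)
    exact ⟨V, hVW, t, hxV, ht⟩
  refine { exact := ?_ }
  -- Exactness means that the map onto the kernel sheaf is epi. Local lifts are compared after the
  -- inclusion of the kernel, which is injective on sections.
  rw [S.exact_iff_epi_kernel_lift]
  refine epi_of_locally_surjective _ fun W s x hx => ?_
  obtain ⟨V, hV, hVW, hxV⟩ := hB' W x hx
  obtain ⟨t, ht⟩ := hfg V hV (S.X₂.rest hVW ((kernel.ι S.g).app W s)) (by
    rw [app_rest]
    have h1 : S.g.app W ((kernel.ι S.g).app W s) = 0 := congr(($(kernel.condition S.g)).app W s)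
    rw [h1]
    exact S.X₃.rest_zero _)
  refine ⟨V, hVW, t, hxV, app_injective_of_mono (kernel.ι S.g) V ?_⟩
  rw [app_rest, ← ht]
  exact congr(($(kernel.lift_ι S.g S.f S.zero)).app V t)

end AlgebraicGeometry.Scheme.Modules

/-! ### Linearization of pointed sets -/

namespace Lin

variable (k : Type u) [CommRing k] {M N P : Type u} [Zero M] [Zero N] [Zero P]

theorem map_map (f : M → N) (hf : f 0 = 0) (g : N → P) (hg : g 0 = 0) (x : Lin k M) :
    map k g hg (map k f hf x) = map k (fun m => g (f m)) (by simp [hf, hg]) x := by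
  have : map k g hg ∘ₗ map k f hf = map k (fun m => g (f m)) (by simp [hf, hg]) :=
    hom_ext fun m => by rw [LinearMap.comp_apply, map_of, map_of, map_of]
  exact congr($this x)

theorem map_eq_self (f : M → M) (hf₀ : f 0 = 0) (hf : ∀ m, f m = m) (x : Lin k M) :
    map k f hf₀ x = x := by
  have : map k f hf₀ = LinearMap.id := hom_ext fun m => by rw [map_of, hf]; rfl
  exact congr($this x)

/-- The coefficient of a basis element of `k[M]`. -/
def coeff {m : M} (hm : m ≠ 0) : Lin k M →ₗ[k] k :=
  Submodule.liftQ _ (Finsupp.lapply m) (by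
    rw [Submodule.span_le, Set.singleton_subset_iff]
    simp [hm.symm])

theorem coeff_of_self {m : M} (hm : m ≠ 0) : coeff k hm (of k m) = 1 := by
  simp [coeff, of]

theorem coeff_of_ne {m m' : M} (hm : m ≠ 0) (h : m' ≠ m) : coeff k hm (of k m') = 0 := by
  simp [coeff, of, h]

/-- A left inverse of `f` again preserves base points, so it can be linearized. -/
theorem map_injective (f : M → N) (hf : f 0 = 0) (hinj : Function.Injective f) :
    Function.Injective (map k f hf) := by
  have h : Function.LeftInverse (Function.invFun f) f := Function.leftInverse_invFun hinj
  intro x y hxy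
  have := congrArg (map k (Function.invFun f) (by rw [← hf, h])) hxy
  rwa [map_map, map_map, map_eq_self k _ _ h, map_eq_self k _ _ h] at this

/-- A map of pointed sets whose fibres over non-zero elements are singletons has a section. -/
theorem exists_pointed_section (p : M → N) (hp : p 0 = 0) (hsurj : Function.Surjective p) :
    ∃ σ : N → M, σ 0 = 0 ∧ ∀ n, p (σ n) = n := by
  classical
  -- The arbitrary choice of preimage is overridden at `0` to keep the section pointed.
  refine ⟨fun n => if n = 0 then 0 else Function.surjInv hsurj n, by simp, fun n => ?_⟩
  by_cases h : n = 0
  · simp [h, hp]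
  · simp [h, Function.surjInv_eq]

theorem map_surjective (p : M → N) (hp : p 0 = 0) (hsurj : Function.Surjective p) :
    Function.Surjective (map k p hp) := by
  obtain ⟨σ, hσ, h⟩ := exists_pointed_section p hp hsurj
  intro y
  refine ⟨map k σ hσ y, ?_⟩
  rw [map_map, map_eq_self k _ _ h]

/-- Since `p` is injective outside the preimage of `0`, the set `N` is the disjoint union of `i(M)`
and a copy of `P \ {0}`. With a retraction `ρ` of `i` and a section `σ` of `p`, this gives `id = iρ
+ σp` on `k[N]`, so an element killed by `p` comes from `k[M]`. The splitting is only `k`-linear. -/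
theorem map_exact (i : M → N) (hi : i 0 = 0) (p : N → P) (hp : p 0 = 0)
    (hinj : Function.Injective i) (hsurj : Function.Surjective p)
    (hip : ∀ n, p n = 0 ↔ n ∈ Set.range i) (hp' : ∀ n n', p n ≠ 0 → p n = p n' → n = n')
    (y : Lin k N) (hy : map k p hp y = 0) : ∃ x, map k i hi x = y := by
  classical
  obtain ⟨σ, hσ, h⟩ := exists_pointed_section p hp hsurj
  let ρ : N → M := fun n => if n ∈ Set.range i then Function.invFun i n else 0
  have hρ : ∀ m, ρ (i m) = m := fun m => by
    simp [ρ, Function.leftInverse_invFun hinj m]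
  have hρ0 : ρ 0 = 0 := by rw [← hi, hρ]
  have key : LinearMap.id = map k i hi ∘ₗ map k ρ hρ0 + map k σ hσ ∘ₗ map k p hp := by
    apply hom_ext
    intro n
    rw [LinearMap.add_apply, LinearMap.comp_apply, LinearMap.comp_apply, map_of, map_of, map_of,
      map_of, LinearMap.id_apply]
    by_cases hn : p n = 0
    · obtain ⟨m, rfl⟩ := (hip n).mp hn
      rw [hρ, hn, hσ, of_zero, add_zero]
    · have h1 : ρ n = 0 := if_neg fun h => hn ((hip n).mpr h)
      rw [h1, hi, of_zero, zero_add, hp' n (σ (p n)) hn (h _).symm]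
      rw [h]
  refine ⟨map k ρ hρ0 y, ?_⟩
  have := congr($key y)
  rw [LinearMap.add_apply, LinearMap.comp_apply, LinearMap.comp_apply, hy, _root_.map_zero,
    add_zero] at this
  exact this.symm

theorem map_comp_eq_zero (i : M → N) (hi : i 0 = 0) (p : N → P) (hp : p 0 = 0)
    (hip : ∀ m, p (i m) = 0) (x : Lin k M) : map k p hp (map k i hi x) = 0 := by
  have : map k p hp ∘ₗ map k i hi = 0 :=
    hom_ext fun m => by rw [LinearMap.comp_apply, map_of, map_of, hip, of_zero]; rfl
  exact congr($this x)

theorem exists_sum_eq (x : Lin k M) : ∃ (S : Finset M) (c : M → k), x = ∑ m ∈ S, c m • of k m := by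
  obtain ⟨y, rfl⟩ := Submodule.Quotient.mk_surjective _ x
  refine ⟨y.support, y, ?_⟩
  have h : y = ∑ m ∈ y.support, y m • Finsupp.single m (1 : k) := by
    conv_lhs => rw [← y.sum_single]
    simp [Finsupp.sum]
  conv_lhs => rw [h]
  exact map_sum (Submodule.mkQ _) _ _

section Localization

variable {A B : Type u} [CommMonoidWithZero A] [CommMonoidWithZero B] [MulActionWithZero A M]
  [MulActionWithZero B N] {φ : A →*₀ B} {f : A} (g : M → N) (hg : g 0 = 0)

/-- Linearization of the surjectivity property of localizations of modules. -/
theorem exists_smul_eq_map (hsurj : ∀ s : N, ∃ (n : ℕ) (t : M), φ (f ^ n) • s = g t)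
    (hφ : ∀ (a : A) (m : M), g (a • m) = φ a • g m) (y : Lin k N) :
    ∃ (n : ℕ) (x : Lin k M), LinAlg.of k (φ f) ^ n • y = map k g hg x := by
  obtain ⟨S, c, rfl⟩ := exists_sum_eq k y
  choose n t ht using hsurj
  -- The sum of the exponents serves as a common denominator; it bounds each `n s`, so the truncated
  -- subtraction is a true one.
  refine ⟨∑ s ∈ S, n s, ∑ s ∈ S, c s • of k (f ^ (∑ s ∈ S, n s - n s) • t s), ?_⟩
  rw [Finset.smul_sum, map_sum]
  refine Finset.sum_congr rfl fun s hs => ?_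
  rw [LinearMap.map_smul, map_of, hφ, ← ht, ← mul_smul, ← map_mul, ← pow_add,
    Nat.sub_add_cancel (Finset.single_le_sum (fun _ _ => Nat.zero_le _) hs), ← of_smul_of,
    map_pow, map_pow]
  exact (map_smul (act k B (M := N) _) (c s) (of k s))

/-- Linearization of the injectivity property of localizations of modules. -/
theorem exists_smul_eq_zero (hg' : ∀ s t : M, g s = g t → ∃ n : ℕ, f ^ n • s = f ^ n • t)
    (x : Lin k M) (hx : map k g hg x = 0) : ∃ n : ℕ, LinAlg.of k f ^ n • x = 0 := by
  classical
  obtain ⟨S, c, hS⟩ := exists_sum_eq k x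
  have hg'' : ∀ s t : M, ∃ n : ℕ, g s = g t → f ^ n • s = f ^ n • t := fun s t => by
    by_cases h : g s = g t
    · obtain ⟨n, hn⟩ := hg' s t h
      exact ⟨n, fun _ => hn⟩
    · exact ⟨0, fun h' => absurd h' h⟩
  choose n hn using hg''
  -- Adding `0` to the support ensures that the map `h` below is pointed.
  let T := insert 0 S
  let d := ∑ s ∈ T, ∑ t ∈ T, n s t
  have hd : ∀ s ∈ T, ∀ t ∈ T, g s = g t → f ^ d • s = f ^ d • t := by
    intro s hs t ht hst
    have h1 : n s t ≤ d :=
      (Finset.single_le_sum (f := fun t => n s t) (fun _ _ => Nat.zero_le _) ht).trans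
        (Finset.single_le_sum (f := fun s => ∑ t ∈ T, n s t) (fun _ _ => Nat.zero_le _) hs)
    rw [← Nat.sub_add_cancel h1, pow_add, mul_smul, mul_smul, hn s t hst]
  -- By the choice of `d`, multiplication by `f ^ d` on `T` factors through `g`, as `h`. Linearizing
  -- `h` turns `g x = 0` into `f ^ d • x = 0`.
  let h : N → M := fun y => if hy : ∃ s ∈ T, g s = y then f ^ d • hy.choose else 0
  have hh : ∀ s ∈ T, h (g s) = f ^ d • s := by
    intro s hs
    have hy : ∃ s' ∈ T, g s' = g s := ⟨s, hs, rfl⟩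
    change dite _ _ _ = _
    rw [dif_pos hy]
    exact hd _ hy.choose_spec.1 s hs hy.choose_spec.2
  have hh0 : h 0 = 0 := by
    rw [← hg, hh 0 (Finset.mem_insert_self _ _), smul_zero]
  refine ⟨d, ?_⟩
  have h1 : map k h hh0 (map k g hg x) = LinAlg.of k f ^ d • x := by
    rw [map_map, hS, map_sum, Finset.smul_sum]
    refine Finset.sum_congr rfl fun s hs => ?_
    rw [LinearMap.map_smul, map_of, hh s (Finset.mem_insert_of_mem hs), ← of_smul_of, map_pow]
    exact (map_smul (act k A (M := M) _) (c s) (of k s)).symm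
  rw [← h1, hx, _root_.map_zero]

end Localization

end Lin

/-! ### Coherent sheaves on affine open sets -/

namespace MonoidalSpace

variable {X : MonoidalSpace.{u}}

namespace AffineChart

variable {U : Opens X.space} (c : X.AffineChart U)

/-- The point is the ideal of non-units, which lies in no proper open subset of `MSpec`. It is the
bridge between stalks and sections over affine open sets. -/
theorem exists_point (c : X.AffineChart U) [Nontrivial (X.sec U)] :
    ∃ x ∈ U, ∀ V : Opens X.space, x ∈ V → U ≤ V := by
  refine ⟨c.toFun (MSpec.closedPoint _), c.range_eq.subset ⟨_, rfl⟩, fun V hV y hy => ?_⟩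
  obtain ⟨q, rfl⟩ := c.range_eq.symm.subset hy
  have := MSpec.eq_univ_of_closedPoint_mem (S := c.toFun ⁻¹' V)
    (V.isOpen.preimage c.isOpenEmbedding.continuous) hV
  exact this.symm.subset (Set.mem_univ q)

theorem isUnit_res (f : X.sec U) (n : ℕ) : IsUnit (res (c.basicOpen_le f) (f ^ n)) :=
  (c.isLocalizationMap_basicOpen f).map_units ⟨f ^ n, n, rfl⟩

/-- If `D(f)` is contained in `D(h)`, then a power of `f` is a multiple of `h`. -/
theorem exists_mul_eq_pow {W : Opens X.space} (d : X.AffineChart W) (h : U ≤ W) (f : X.sec U)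
    (g : X.sec W) (hfg : c.basicOpen f ≤ d.basicOpen g) :
    ∃ (b : X.sec U) (n : ℕ), b * res h g = f ^ n := by
  have h1 : IsUnit (res (c.basicOpen_le f) (res h g)) := by
    rw [res_res, ← res_res (d.basicOpen_le g) hfg]
    simpa using (d.isUnit_res g 1).map (res hfg)
  obtain ⟨v, hv⟩ := h1.exists_left_inv
  obtain ⟨a, n, ha⟩ := MSpec.exists_num (c.isLocalizationMap_basicOpen f) v
  have h2 : res (c.basicOpen_le f) (a * res h g) = res (c.basicOpen_le f) (f ^ n) := by
    rw [_root_.map_mul, ← ha, mul_right_comm, hv, one_mul]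
  obtain ⟨⟨_, m, rfl⟩, hm⟩ := (c.isLocalizationMap_basicOpen f).exists_of_eq h2
  refine ⟨f ^ m * a, m + n, ?_⟩
  rw [mul_assoc, pow_add]
  exact hm

end AffineChart

end MonoidalSpace

theorem MonoidScheme.isBasis_affineOpens (X : MonoidScheme.{u}) :
    Opens.IsBasis {U : Opens X.space | X.IsAffineOpen U} := by
  rw [Opens.isBasis_iff_nbhd]
  intro W x hx
  obtain ⟨U, hxU, ⟨c⟩⟩ := X.exists_isAffineOpen x
  obtain ⟨p, rfl⟩ := c.range_eq.symm.subset hxU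
  obtain ⟨_, ⟨f, rfl⟩, hpf, hfW⟩ :=
    MSpec.isTopologicalBasis_basicOpen.exists_subset_of_mem_open (show p ∈ c.toFun ⁻¹' W from hx)
      (W.isOpen.preimage c.isOpenEmbedding.continuous)
  refine ⟨c.basicOpen f, c.isAffineOpen_basicOpen f, ⟨p, hpf, rfl⟩, ?_⟩
  rintro _ ⟨q, hq, rfl⟩
  exact hfW hq

namespace OModule

variable {X : MonoidalSpace.{u}}

theorem res_res (F : OModule X) {U V W : Opens X.space} (h : V ≤ U) (h' : W ≤ V) (s : F.sec U) :
    F.res h' (F.res h s) = F.res (h'.trans h) s := by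
  change F.presheaf.map _ (F.presheaf.map _ s) = F.presheaf.map _ s
  rw [← ConcreteCategory.comp_apply, ← Functor.map_comp]
  rfl

theorem res_refl (F : OModule X) {U : Opens X.space} (s : F.sec U) : F.res le_rfl s = s := by
  change F.presheaf.map (𝟙 _) s = s
  simp

/-- The map on sections induced by a morphism. -/
def Hom.app {F G : OModule X} (φ : F ⟶ G) (U : Opens X.space) (s : F.sec U) : G.sec U :=
  (Hom.val φ).app (op U) s

theorem Hom.app_res {F G : OModule X} (φ : F ⟶ G) {U V : Opens X.space} (h : V ≤ U)
    (s : F.sec U) : Hom.app φ V (F.res h s) = G.res h (Hom.app φ U s) :=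
  congr($((Hom.val φ).naturality (homOfLE h).op) s)

theorem Hom.app_smul {F G : OModule X} (φ : F ⟶ G) {U : Opens X.space} (a : X.sec U)
    (s : F.sec U) : Hom.app φ U (a • s) = a • Hom.app φ U s :=
  Hom.map_smul φ U a s

theorem Hom.app_zero {F G : OModule X} (φ : F ⟶ G) (U : Opens X.space) :
    Hom.app φ U (0 : F.sec U) = 0 :=
  Hom.map_zero φ U

theorem smul_injective (F : OModule X) {U : Opens X.space} {a : X.sec U} (ha : IsUnit a)
    {s t : F.sec U} (h : a • s = a • t) : s = t := by
  obtain ⟨b, hb⟩ := ha.exists_left_inv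
  rw [← one_smul (X.sec U) s, ← hb, mul_smul, h, ← mul_smul, hb, one_smul]

/-- This handles the degenerate case `1 = 0`, in which an affine open set is empty and has no closed
point. -/
theorem subsingleton_sec (F : OModule X) (U : Opens X.space) [Subsingleton (X.sec U)] :
    Subsingleton (F.sec U) := by
  refine ⟨fun s t => ?_⟩
  rw [← one_smul (X.sec U) s, ← one_smul (X.sec U) t, Subsingleton.elim (1 : X.sec U) 0, zero_smul,
    zero_smul]

theorem subsingleton_sec_of_le {U V : Opens X.space} (h : V ≤ U) [Subsingleton (X.sec U)] :
    Subsingleton (X.sec V) := by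
  refine subsingleton_of_zero_eq_one ?_
  rw [← _root_.map_zero (MonoidalSpace.res h), Subsingleton.elim (0 : X.sec U) 1, map_one]

/-- If `F` is `M~` on an affine open set, then so it is on the affine open sets contained in it. -/
theorem IsTilde.of_le {F : OModule X} {U W : Opens X.space} {d : X.AffineChart W}
    (hF : F.IsTilde d) (c : X.AffineChart U) (h : U ≤ W) : F.IsTilde c := by
  obtain ⟨g, rfl⟩ := d.exists_eq_basicOpen ⟨c⟩ h
  constructor
  · intro f s
    -- The set `D(f) ⊆ U` is also `D(e)` for some `e` on `W`, and `e` divides a power of `f` on `U`.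
    -- So denominators that are powers of `e` can be replaced by powers of `f`.
    obtain ⟨e, he⟩ := d.exists_eq_basicOpen (c.isAffineOpen_basicOpen f)
      ((c.basicOpen_le f).trans h)
    obtain ⟨b, m, hb⟩ := c.exists_mul_eq_pow d h f e he.le
    obtain ⟨n, t, ht⟩ := hF.surj e (F.res he.ge s)
    refine ⟨m * n, b ^ n • F.res h t, ?_⟩
    have ht' := congrArg (F.res he.le) ht
    rw [res_smul, res_res, res_res, res_refl, MonoidalSpace.res_res] at ht'
    rw [pow_mul, ← hb, mul_pow, _root_.map_mul, mul_smul, res_smul, res_res, ← ht', map_pow,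
      map_pow _ (MonoidalSpace.res h e), MonoidalSpace.res_res, map_pow]
  · intro f s t hst
    obtain ⟨e, he⟩ := d.exists_eq_basicOpen (c.isAffineOpen_basicOpen f)
      ((c.basicOpen_le f).trans h)
    obtain ⟨b, m, hb⟩ := c.exists_mul_eq_pow d h f e he.le
    -- As `U = D(g)`, both sections extend to `W` up to powers of `g`, and the hypothesis for `W`
    -- applies to the extensions.
    obtain ⟨n, s', hs'⟩ := hF.surj g s
    obtain ⟨n', t', ht'⟩ := hF.surj g t
    have h1 : F.res (d.basicOpen_le e) (g ^ n' • s') = F.res (d.basicOpen_le e) (g ^ n • t') := by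
      have h2 : F.res (c.basicOpen_le f) (F.res h (g ^ n' • s')) =
          F.res (c.basicOpen_le f) (F.res h (g ^ n • t')) := by
        rw [F.res_smul h, F.res_smul h, ← hs', ← ht', smul_smul, smul_smul, mul_comm, res_smul,
          res_smul _ _ _ t, hst]
      have h3 := congrArg (F.res he.ge) h2
      rwa [res_res, res_res, res_res, res_res] at h3
    obtain ⟨k, hk⟩ := hF.exists_of_eq e _ _ h1
    have h4 := congrArg (F.res h) hk
    have hs'' : MonoidalSpace.res h (g ^ n) • s = F.res h s' := hs'
    have ht'' : MonoidalSpace.res h (g ^ n') • t = F.res h t' := ht'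
    rw [res_smul, res_smul, res_smul, res_smul, ← hs'', ← ht''] at h4
    -- The auxiliary powers of `g` are units on `U` and can be cancelled.
    have hu : ∀ n, IsUnit (MonoidalSpace.res h (g ^ n)) := d.isUnit_res g
    have h5 := F.smul_injective ((hu n').mul (hu n))
      (s := MonoidalSpace.res h (e ^ k) • s) (t := MonoidalSpace.res h (e ^ k) • t)
      (by simpa only [smul_smul, mul_comm, mul_left_comm] using h4)
    refine ⟨m * k, ?_⟩
    rw [pow_mul, ← hb, mul_pow, mul_smul, mul_smul, ← map_pow, h5]

/-- A coherent sheaf is of the form `M~` on all affine open sets, with `M` finitely generated. -/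
theorem IsCoherent.affine {F : OModule X} (hF : F.IsCoherent) {U : Opens X.space}
    (c : X.AffineChart U) :
    F.IsTilde c ∧ ∃ S : Finset (F.sec U), ∀ m : F.sec U, ∃ (a : X.sec U), ∃ s ∈ S, m = a • s := by
  classical
  rcases subsingleton_or_nontrivial (X.sec U) with hU | hU
  · have := F.subsingleton_sec U
    refine ⟨⟨fun f s => ⟨0, 0, ?_⟩, fun f s t _ => ⟨0, Subsingleton.elim _ _⟩⟩, {0},
      fun m => ⟨0, 0, by simp, Subsingleton.elim _ _⟩⟩
    have := subsingleton_sec_of_le (c.basicOpen_le f)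
    have := F.subsingleton_sec (c.basicOpen f)
    exact Subsingleton.elim _ _
  · obtain ⟨x, hxU, hx⟩ := c.exists_point
    -- An affine neighbourhood of the closed point of `U` on which `F` is `M~` contains all of `U`,
    -- so the structure on it restricts to `U`.
    obtain ⟨W, d, hxW, hd, S, hS⟩ := hF x
    have hUW := hx W hxW
    refine ⟨hd.of_le c hUW, S.image (F.res hUW), fun m => ?_⟩
    obtain ⟨g, rfl⟩ := d.exists_eq_basicOpen ⟨c⟩ hUW
    obtain ⟨n, t, ht⟩ := hd.surj g m
    obtain ⟨a, s, hs, rfl⟩ := hS t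
    obtain ⟨b, hb⟩ := (d.isUnit_res g n).exists_left_inv
    refine ⟨b * MonoidalSpace.res hUW a, F.res hUW s, Finset.mem_image_of_mem _ hs, ?_⟩
    rw [mul_smul, ← res_smul, ← ht, smul_smul, hb, one_smul]

theorem germ_res (F : OModule X) {U V : Opens X.space} (h : V ≤ U) {x : X.space} (hx : x ∈ V)
    (s : F.sec U) : F.germ hx (F.res h s) = F.germ (h hx) s :=
  TopCat.Presheaf.germ_res_apply F.presheaf (homOfLE h) x hx s

/-- By `hx`, `U` is the smallest open neighbourhood of `x`; with `germ_surjective` this identifies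
the stalk at `x` with `F(U)`. -/
theorem germ_injective (F : OModule X) {U : Opens X.space} {x : X.space} (hxU : x ∈ U)
    (hx : ∀ V : Opens X.space, x ∈ V → U ≤ V) :
    Function.Injective (F.germ hxU) := by
  intro s t h
  obtain ⟨W, hxW, i, i', hst⟩ := TopCat.Presheaf.germ_eq F.presheaf x hxU hxU s t h
  have h1 : F.res i.le s = F.res i'.le t := hst
  have h2 := congrArg (F.res (hx W hxW)) h1
  rwa [res_res, res_res, res_refl, res_refl] at h2

theorem germ_surjective (F : OModule X) {U : Opens X.space} {x : X.space} (hxU : x ∈ U)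
    (hx : ∀ V : Opens X.space, x ∈ V → U ≤ V) :
    Function.Surjective (F.germ hxU) := by
  intro z
  obtain ⟨V, hxV, s, hs⟩ := TopCat.Presheaf.exists_germ_eq F.presheaf z
  refine ⟨F.res (hx V hxV) s, ?_⟩
  rw [germ_res]
  exact hs

/-- Sections over open sets are determined by their restrictions to affine open sets. -/
theorem sec_ext {X : MonoidScheme.{u}} (F : OModule X.toMonoidalSpace) {W : Opens X.space}
    {s t : F.sec W}
    (h : ∀ U : X.AffineOpens, ∀ hU : U.1 ≤ W, F.res hU s = F.res hU t) : s = t := by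
  refine TopCat.Sheaf.eq_of_locally_eq' ⟨F.presheaf, F.isSheaf⟩
    (fun U : {U : X.AffineOpens // U.1 ≤ W} => U.1.1) W (fun U => homOfLE U.2) ?_ s t
    (fun U => h U.1 U.2)
  intro x hx
  obtain ⟨V, hV, hxV, hVW⟩ := Opens.isBasis_iff_nbhd.mp X.isBasis_affineOpens hx
  exact Opens.mem_iSup.mpr ⟨⟨⟨V, hV⟩, hVW⟩, hxV⟩

end OModule

open Scheme.Modules

/-! ### The realization over affine open sets -/

namespace MonoidScheme

variable (X : MonoidScheme.{u}) (k : Type u) [CommRing k]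

instance (U : X.AffineOpens) : IsOpenImmersion (X.realizationι k U) :=
  inferInstanceAs (IsOpenImmersion (colimit.ι (X.realizationDiagram k) U))

instance {U V : X.AffineOpens} (h : V ≤ U) : IsOpenImmersion (Spec.map (X.linRes k h)) :=
  inferInstanceAs (IsOpenImmersion ((X.realizationDiagram k).map (homOfLE h)))

theorem exists_realizationι_eq (y : X.realization k) :
    ∃ (U : X.AffineOpens) (x : Spec (CommRingCat.of (LinAlg k (X.sec U.1)))),
      X.realizationι k U x = y :=
  Scheme.IsLocallyDirected.ι_jointly_surjective (X.realizationDiagram k) y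

theorem opensRange_mono {U V : X.AffineOpens} (h : V ≤ U) :
    (X.realizationι k V).opensRange ≤ (X.realizationι k U).opensRange := by
  rintro _ ⟨x, rfl⟩
  rw [← X.map_realizationι k h]
  exact ⟨Spec.map (X.linRes k h) x, rfl⟩

/-- The gluing diagram is locally directed, so intersections of charts are covered by charts. This
is the directedness hypothesis of the gluing lemma. -/
theorem exists_mem_opensRange {U V : X.AffineOpens} {y : X.realization k}
    (hU : y ∈ (X.realizationι k U).opensRange) (hV : y ∈ (X.realizationι k V).opensRange) :
    ∃ W : X.AffineOpens, W ≤ U ∧ W ≤ V ∧ y ∈ (X.realizationι k W).opensRange := by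
  obtain ⟨x, rfl⟩ := hU
  obtain ⟨x', hx'⟩ := hV
  obtain ⟨W, i, j, z, hz, -⟩ :=
    (Scheme.IsLocallyDirected.ι_eq_ι_iff (X.realizationDiagram k)).mp hx'.symm
  refine ⟨W, i.le, j.le, z, ?_⟩
  rw [← hz, ← X.map_realizationι k i.le]
  rfl

theorem opensRange_linRes {U : Opens X.space} (c : X.AffineChart U) (f : X.sec U)
    [IsOpenImmersion (Spec.map (X.linRes k (c.basicOpen_le f)))] :
    (Spec.map (X.linRes k (c.basicOpen_le f))).opensRange =
      PrimeSpectrum.basicOpen (LinAlg.of k f) := by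
  ext x
  exact X.mem_range_linRes k c f x

end MonoidScheme

namespace OModule

variable {X : MonoidScheme.{u}} (k : Type u) [CommRing k] (F : OModule X.toMonoidalSpace)

theorem preimage_le {U V : X.AffineOpens} (h : V ≤ U) (W : (X.realization k).Opens) :
    X.realizationι k V ⁻¹ᵁ W ≤ Spec.map (X.linRes k h) ⁻¹ᵁ X.realizationι k U ⁻¹ᵁ W := by
  rw [← X.map_realizationι k h]
  rfl

theorem pieceRes_app {U V : X.AffineOpens} (h : V ≤ U) (W : (X.realization k).Opens)
    (s : Γ(tilde (F.linSec k U.1), X.realizationι k U ⁻¹ᵁ W)) :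
    (F.pieceRes k h).app W s = (tilde (F.linSec k V.1)).rest (preimage_le k h W)
      ((tildeHom (X.linRes k h) (F.linSecRes k h)).app (X.realizationι k U ⁻¹ᵁ W) s) :=
  rfl

theorem pieceRes_trans {U V W : X.AffineOpens} (h : V ≤ U) (h' : W ≤ V) :
    F.pieceRes k h ≫ F.pieceRes k h' = F.pieceRes k (h'.trans h) := by
  have hr : Spec.map (X.linRes k h') ≫ Spec.map (X.linRes k h) =
      Spec.map (X.linRes k (h'.trans h)) :=
    ((X.realizationDiagram k).map_comp (homOfLE h') (homOfLE h)).symm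
  have h1 := tildeHom_comp hr (F.linSecRes k h) (F.linSecRes k h') (F.linSecRes k (h'.trans h)) (by
    intro m
    have : Lin.map k (F.res (h'.trans h)) (F.res_zero _) =
        Lin.map k (F.res h') (F.res_zero h') ∘ₗ Lin.map k (F.res h) (F.res_zero h) :=
      Lin.hom_ext fun m => by
        rw [LinearMap.comp_apply, Lin.map_of, Lin.map_of, Lin.map_of, res_res]
    exact congr($this m))
  ext W s
  rw [Hom.comp_app, ConcreteCategory.comp_apply]
  refine (pieceRes_app k F h' W _).trans (Eq.trans ?_ (pieceRes_app k F (h'.trans h) W s).symm)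
  rw [← h1]
  refine Eq.trans (congrArg _ (congrArg _ (pieceRes_app k F h W s))) ?_
  refine (congrArg _ (app_rest (tildeHom (X.linRes k h') (F.linSecRes k h')) _ _)).trans ?_
  exact (rest_rest (tilde (F.linSec k _)) _ _ _).trans (rest_rest (tilde (F.linSec k _)) _ _ _).symm

/-- Here `V = D(f)` in `U`, and `F(V)` is the localization of `F(U)` at `f`. This property survives
linearization, so `k[F(U)]~` restricts to `k[F(V)]~` on `Spec k[𝒪(V)]`. -/
theorem pieceRes_bijective {U V : X.AffineOpens} (h : V ≤ U) (c : X.AffineChart U.1)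
    (hF : F.IsTilde c) (W : (X.realization k).Opens) (hW : W ≤ (X.realizationι k V).opensRange) :
    Function.Bijective ((F.pieceRes k h).app W) := by
  suffices h1 : Function.Bijective
      ((tildeHom (X.linRes k h) (F.linSecRes k h)).app (X.realizationι k U ⁻¹ᵁ W)) by
    have h2 : X.realizationι k V ⁻¹ᵁ W =
        Spec.map (X.linRes k h) ⁻¹ᵁ X.realizationι k U ⁻¹ᵁ W := by
      rw [← X.map_realizationι k h]
      rfl
    exact ((tilde (F.linSec k V.1)).rest_bijective_of_eq h2).comp h1
  refine (isIso_restrictHom_iff _ _).mp ?_ _ ?_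
  · obtain ⟨V, hV⟩ := V
    obtain ⟨f, rfl⟩ := c.exists_eq_basicOpen hV h
    have := X.isOpenImmersion_linRes k c f
    refine isIso_restrictHom_tildeHom _ _ (LinAlg.of k f) (X.opensRange_linRes k c f) ?_ ?_
    · intro y
      obtain ⟨n, x, hx⟩ := Lin.exists_smul_eq_map k (φ := MonoidalSpace.res (c.basicOpen_le f))
        (F.res (c.basicOpen_le f)) (F.res_zero _) (hF.surj f) (F.res_smul _) y
      refine ⟨n, x, Eq.trans ?_ hx⟩
      exact congrArg (· ^ n • y) (LinAlg.map_of k _ f)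
    · exact Lin.exists_smul_eq_zero k (F.res (c.basicOpen_le f)) (F.res_zero _)
        (hF.exists_of_eq f)
  · intro x hx
    obtain ⟨z, hz⟩ := hW hx
    refine ⟨z, (X.realizationι k U).isOpenEmbedding.injective ?_⟩
    rw [← hz, ← X.map_realizationι k h]
    rfl

/-- Over `Spec k[𝒪(U)]`, the realization of a coherent sheaf `F` is `k[F(U)]~`. -/
theorem realizationπ_bijective (hF : F.IsCoherent) (U : X.AffineOpens)
    (W : (X.realization k).Opens) (hW : W ≤ (X.realizationι k U).opensRange) :
    Function.Bijective ((F.realizationπ k U).app W) := by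
  have key := existsUnique_compatible_family
    (fun U : X.AffineOpens => (X.realizationι k U).opensRange)
    (F.piece k) (fun {U V} h => F.pieceRes k h) (fun h h' => F.pieceRes_trans k h h')
    (fun h => X.opensRange_mono k h) (fun U W => rest_pushforward_bijective _ _ W)
    (fun {U V} h W hW => F.pieceRes_bijective k h U.2.some (hF.affine _).1 W hW)
    (fun U V y hU hV => X.exists_mem_opensRange k hU hV) hW
  have hres : ∀ {V V' : X.AffineOpens} (h : V' ≤ V) (s : Γ(F.realization k, W)),
      (F.pieceRes k h).app W ((F.realizationπ k V).app W s) = (F.realizationπ k V').app W s := by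
    intro V V' h s
    rw [← F.realizationπ_res k h]
    rfl
  constructor
  · intro s t hst
    apply app_injective_of_mono (equalizer.ι _ _) W
    refine pi_section_ext _ W fun V => ?_
    change (F.realizationπ k V).app W s = (F.realizationπ k V).app W t
    exact congrFun ((key _).unique ⟨rfl, fun h => hres h s⟩ ⟨hst.symm, fun h => hres h t⟩) V
  · intro s
    obtain ⟨t, ⟨ht, ht'⟩, -⟩ := key s
    -- Sections over `W` commute with limits, so the compatible family is a section of the product
    -- and then of the equalizer.
    obtain ⟨t₁, ht₁⟩ := exists_pi_section (F.piece k) W t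
    obtain ⟨t₂, ht₂⟩ := exists_equalizer_section
      (Pi.lift fun q : AffinePairs X => Pi.π (F.piece k) q.1.2)
      (Pi.lift fun q : AffinePairs X => Pi.π (F.piece k) q.1.1 ≫ F.pieceRes k q.2) W t₁ (by
        refine pi_section_ext _ W fun q => ?_
        have e1 : ∀ {K : (X.realization k).Modules} {P : AffinePairs X → (X.realization k).Modules}
            (g : ∀ q, K ⟶ P q) (x : Γ(K, W)),
            (Pi.π P q).app W ((Pi.lift g).app W x) = (g q).app W x := by
          intro K P g x
          exact congr(($(Pi.lift_π g q)).app W x)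
        rw [e1, e1, Hom.comp_app, ConcreteCategory.comp_apply, ht₁, ht₁]
        exact (ht' q.2).symm)
    refine ⟨t₂, ?_⟩
    rw [← ht, ← ht₁ U, ← ht₂]
    rfl

end OModule

/-! ### Coherence of the realization -/

namespace OModule

variable {X : MonoidScheme.{u}} (k : Type u) [CommRing k]

/-- The restriction of `F_k` to `Spec k[𝒪(U)]` maps to `k[F(U)]~`. -/
def realizationRestrictHom (F : OModule X.toMonoidalSpace) (U : X.AffineOpens) :
    (F.realization k).restrict (X.realizationι k U) ⟶ tilde (F.linSec k U.1) :=
  restrictHom (X.realizationι k U) (F.realizationπ k U)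

theorem isIso_realizationRestrictHom {F : OModule X.toMonoidalSpace} (hF : F.IsCoherent)
    (U : X.AffineOpens) : IsIso (F.realizationRestrictHom k U) :=
  (isIso_restrictHom_iff _ _).mpr fun W hW => F.realizationπ_bijective k hF U W hW

theorem realizationRestrictHom_naturality {F G : OModule X.toMonoidalSpace} (φ : F ⟶ G)
    (U : X.AffineOpens) :
    F.realizationRestrictHom k U ≫ tilde.map (linSecMap k φ U.1) =
      (restrictFunctor (X.realizationι k U)).map (realizationMap k φ) ≫
        G.realizationRestrictHom k U :=
  restrictHom_naturality _ (realizationMap_π k φ U).symm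

/-- Every basis element of `k[F(U)]` is a multiple, by a basis element of `k[𝒪(U)]`, of one attached
to a generator. -/
theorem finite_linSec (F : OModule X.toMonoidalSpace) (U : Opens X.space) (S : Finset (F.sec U))
    (hS : ∀ m : F.sec U, ∃ (a : X.sec U), ∃ s ∈ S, m = a • s) :
    Module.Finite (LinAlg k (X.sec U)) (Lin k (F.sec U)) := by
  classical
  refine ⟨⟨S.image (Lin.of k), ?_⟩⟩
  rw [eq_top_iff]
  rintro y -
  obtain ⟨T, c, rfl⟩ := Lin.exists_sum_eq k y
  refine Submodule.sum_mem _ fun m _ => ?_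
  obtain ⟨a, s, hs, rfl⟩ := hS m
  have h1 : c (a • s) • Lin.of k (a • s) =
      (c (a • s) • (LinAlg.of k a)) • (Lin.of k s : Lin k (F.sec U)) := by
    rw [Lin.smul_algebra_smul, Lin.of_smul_of]
  rw [h1]
  exact Submodule.smul_mem _ _ (Submodule.subset_span (Finset.mem_coe.mpr
    (Finset.mem_image_of_mem _ hs)))

theorem isCoherentModule_realization {F : OModule X.toMonoidalSpace} (hF : F.IsCoherent) :
    isCoherentModule (X.realization k) (F.realization k) := by
  intro y
  obtain ⟨U, x, rfl⟩ := X.exists_realizationι_eq k y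
  obtain ⟨S, hS⟩ := (hF.affine U.2.some).2
  have := isIso_realizationRestrictHom k hF U
  exact ⟨_, X.realizationι k U, inferInstance, F.linSec k U.1, ⟨x, rfl⟩,
    F.finite_linSec k U.1 S hS, ⟨asIso (F.realizationRestrictHom k U)⟩⟩

end OModule

/-! ### A basis of open sets of the realization -/

namespace MonoidScheme

variable (X : MonoidScheme.{u}) (k : Type u) [CommRing k]

theorem isBasis_realization : Opens.IsBasis {W : (X.realization k).Opens |
    ∃ (U : X.AffineOpens) (f : LinAlg k (X.sec U.1)),
      W = X.realizationι k U ''ᵁ PrimeSpectrum.basicOpen f} := by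
  rw [Opens.isBasis_iff_nbhd]
  intro W y hy
  obtain ⟨U, x, rfl⟩ := X.exists_realizationι_eq k y
  obtain ⟨_, ⟨_, ⟨f, rfl⟩, rfl⟩, hxf, hf⟩ :=
    PrimeSpectrum.isBasis_basic_opens.exists_subset_of_mem_open
      (show x ∈ (X.realizationι k U ⁻¹ᵁ W : Set _) from hy) (X.realizationι k U ⁻¹ᵁ W).2
  refine ⟨_, ⟨U, f, rfl⟩, ⟨x, hxf, rfl⟩, ?_⟩
  rintro _ ⟨z, hz, rfl⟩
  exact hf hz

end MonoidScheme

/-! ### Admissible sequences on affine open sets, and exactness of realization -/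

namespace CohAlpha

variable {X : MonoidScheme.{u}} {F' F : CohAlpha X}

/-- Type `α` at the closed point of `U` is a statement about sections over `U`. The conditions on
extensions are transferred in the same way below. -/
theorem eq_or_smul_eq_zero (G : CohAlpha X) (U : X.AffineOpens) (a : X.sec U.1)
    (s t : G.obj.sec U.1) (h : a • s = a • t) : s = t ∨ a • s = 0 := by
  obtain ⟨U, ⟨c⟩⟩ := U
  rcases subsingleton_or_nontrivial (X.sec U) with hU | hU
  · have := G.obj.subsingleton_sec U
    exact .inl (Subsingleton.elim _ _)
  · obtain ⟨x, hxU, hx⟩ := c.exists_point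
    refine (G.isTypeAlpha x U hxU a s t (congrArg _ h)).imp
      (fun h => G.obj.germ_injective hxU hx h) fun h => G.obj.germ_injective hxU hx ?_
    rw [h.1, OModule.germ_zero]

namespace Extension

variable (E : Extension F' F) (U : X.AffineOpens)

theorem app_i_injective : Function.Injective (OModule.Hom.app E.i.hom U.1) := by
  obtain ⟨U, ⟨c⟩⟩ := U
  rcases subsingleton_or_nontrivial (X.sec U) with hU | hU
  · have := F.obj.subsingleton_sec U
    exact Function.injective_of_subsingleton _
  · obtain ⟨x, hxU, hx⟩ := c.exists_point
    intro s t h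
    apply F.obj.germ_injective hxU hx
    apply E.injective x
    rw [stalkMap, OModule.Hom.stalkMap_germ, OModule.Hom.stalkMap_germ]
    exact congrArg _ h

theorem app_p_surjective : Function.Surjective (OModule.Hom.app E.p.hom U.1) := by
  obtain ⟨U, ⟨c⟩⟩ := U
  rcases subsingleton_or_nontrivial (X.sec U) with hU | hU
  · have := F'.obj.subsingleton_sec U
    exact fun s => ⟨0, Subsingleton.elim _ _⟩
  · obtain ⟨x, hxU, hx⟩ := c.exists_point
    intro s
    obtain ⟨z, hz⟩ := E.surjective x (F'.obj.germ hxU s)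
    obtain ⟨t, rfl⟩ := E.mid.obj.germ_surjective hxU hx z
    refine ⟨t, F'.obj.germ_injective hxU hx ?_⟩
    rw [← hz, stalkMap, OModule.Hom.stalkMap_germ]
    rfl

theorem app_p_eq_zero_iff (s : E.mid.obj.sec U.1) :
    OModule.Hom.app E.p.hom U.1 s = 0 ↔ s ∈ Set.range (OModule.Hom.app E.i.hom U.1) := by
  obtain ⟨U, ⟨c⟩⟩ := U
  rcases subsingleton_or_nontrivial (X.sec U) with hU | hU
  · have := F'.obj.subsingleton_sec U
    have := E.mid.obj.subsingleton_sec U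
    exact ⟨fun _ => ⟨0, Subsingleton.elim _ _⟩, fun _ => Subsingleton.elim _ _⟩
  · obtain ⟨x, hxU, hx⟩ := c.exists_point
    have h1 : OModule.Hom.app E.p.hom U s = 0 ↔ stalkMap E.p x (E.mid.obj.germ hxU s) = 0 := by
      rw [stalkMap, OModule.Hom.stalkMap_germ, ← F'.obj.germ_zero hxU]
      exact (F'.obj.germ_injective hxU hx).eq_iff.symm
    rw [h1, E.exact]
    constructor
    · rintro ⟨z, hz⟩
      obtain ⟨t, rfl⟩ := F.obj.germ_surjective hxU hx z
      refine ⟨t, E.mid.obj.germ_injective hxU hx ?_⟩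
      rw [← hz, stalkMap, OModule.Hom.stalkMap_germ]
      rfl
    · rintro ⟨t, rfl⟩
      refine ⟨F.obj.germ hxU t, ?_⟩
      rw [stalkMap, OModule.Hom.stalkMap_germ]
      rfl

theorem app_p_app_i (s : F.obj.sec U.1) :
    OModule.Hom.app E.p.hom U.1 (OModule.Hom.app E.i.hom U.1 s) = 0 :=
  (E.app_p_eq_zero_iff U _).mpr ⟨s, rfl⟩

theorem eq_of_app_p_eq (s t : E.mid.obj.sec U.1) (h0 : OModule.Hom.app E.p.hom U.1 s ≠ 0)
    (h : OModule.Hom.app E.p.hom U.1 s = OModule.Hom.app E.p.hom U.1 t) : s = t := by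
  obtain ⟨U, ⟨c⟩⟩ := U
  rcases subsingleton_or_nontrivial (X.sec U) with hU | hU
  · have := E.mid.obj.subsingleton_sec U
    exact Subsingleton.elim _ _
  · obtain ⟨x, hxU, hx⟩ := c.exists_point
    apply E.mid.obj.germ_injective hxU hx
    apply E.p.isTypeAlpha x
    · rw [OModule.Hom.stalkMap_germ, ← F'.obj.germ_zero hxU]
      exact fun h => h0 (F'.obj.germ_injective hxU hx h)
    · rw [OModule.Hom.stalkMap_germ, OModule.Hom.stalkMap_germ]
      exact congrArg _ h

variable (k : Type u) [CommRing k]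

theorem linSecMap_i_injective : Function.Injective (OModule.linSecMap k E.i.hom U.1).hom :=
  Lin.map_injective k _ (OModule.Hom.map_zero _ _) (E.app_i_injective U)

theorem linSecMap_p_surjective : Function.Surjective (OModule.linSecMap k E.p.hom U.1).hom :=
  Lin.map_surjective k _ (OModule.Hom.map_zero _ _) (E.app_p_surjective U)

theorem exists_linSecMap_i_eq (y : E.mid.obj.linSec k U.1)
    (hy : (OModule.linSecMap k E.p.hom U.1).hom y = 0) :
    ∃ x, (OModule.linSecMap k E.i.hom U.1).hom x = y :=
  Lin.map_exact k _ (OModule.Hom.map_zero _ _) _ (OModule.Hom.map_zero _ _) (E.app_i_injective U)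
    (E.app_p_surjective U) (E.app_p_eq_zero_iff U) (E.eq_of_app_p_eq U) y hy

theorem linSecMap_comp_eq_zero :
    OModule.linSecMap k E.i.hom U.1 ≫ OModule.linSecMap k E.p.hom U.1 = 0 := by
  ext x
  exact Lin.map_comp_eq_zero k _ (OModule.Hom.map_zero _ _) _ (OModule.Hom.map_zero _ _)
    (E.app_p_app_i U) x

theorem realizationMap_comp_eq_zero :
    OModule.realizationMap k E.i.hom ≫ OModule.realizationMap k E.p.hom = 0 := by
  refine OModule.realization_hom_ext k _ fun U => ?_
  rw [Category.assoc, OModule.realizationMap_π, reassoc_of% OModule.realizationMap_π k E.i.hom U,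
    OModule.pieceMap, OModule.pieceMap, ← Functor.map_comp, ← tilde.map_comp,
    E.linSecMap_comp_eq_zero, tilde.map_zero, Functor.map_zero, comp_zero, zero_comp]

/-- On the basic open subsets of a chart `Spec k[𝒪(U)]`, the three realizations have the sections of
the sheaves `k[-(U)]~`, so exactness comes from that of the linearized sections over `U`. -/
theorem shortExact_realization :
    (ShortComplex.mk _ _ (E.realizationMap_comp_eq_zero k)).ShortExact := by
  have hπ : ∀ {G H : OModule X.toMonoidalSpace} (φ : G ⟶ H) (U : X.AffineOpens)
      (W : (X.realization k).Opens) (s : Γ(G.realization k, W)),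
      (H.realizationπ k U).app W ((OModule.realizationMap k φ).app W s) =
        (tilde.map (OModule.linSecMap k φ U.1)).app (X.realizationι k U ⁻¹ᵁ W)
          ((G.realizationπ k U).app W s) :=
    fun φ U W s => congr(($(OModule.realizationMap_π k φ U)).app W s)
  have hb : ∀ (G : CohAlpha X) (U : X.AffineOpens) (f : LinAlg k (X.sec U.1)),
      Function.Bijective ((G.obj.realizationπ k U).app
        (X.realizationι k U ''ᵁ PrimeSpectrum.basicOpen f)) :=
    fun G U f => G.obj.realizationπ_bijective k G.isCoherent U _
      ((X.realizationι k U).image_le_opensRange _)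
  refine shortExact_of_basis _ (X.isBasis_realization k) ?_ ?_ ?_
  · rintro _ ⟨U, f, rfl⟩ s t hst
    apply (hb F U f).1
    apply tilde_map_app_injective (OModule.linSecMap k E.i.hom U.1) f
      ((X.realizationι k U).preimage_image_eq _) (E.linSecMap_i_injective U k)
    rw [← hπ, ← hπ]
    exact congrArg _ hst
  · rintro _ ⟨U, f, rfl⟩ s hs
    obtain ⟨y, hy⟩ := tilde_map_app_exact (OModule.linSecMap k E.i.hom U.1)
      (OModule.linSecMap k E.p.hom U.1) f ((X.realizationι k U).preimage_image_eq _)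
      (E.exists_linSecMap_i_eq U k) ((E.mid.obj.realizationπ k U).app _ s)
      ((hπ E.p.hom U _ s).symm.trans ((congrArg _ hs).trans (AddMonoidHom.map_zero _)))
    obtain ⟨t, rfl⟩ := (hb F U f).2 y
    refine ⟨t, (hb E.mid U f).1 ?_⟩
    rw [← hy]
    exact hπ E.i.hom U _ t
  · rintro _ ⟨U, f, rfl⟩ s
    obtain ⟨y, hy⟩ := tilde_map_app_surjective (OModule.linSecMap k E.p.hom U.1) f
      ((X.realizationι k U).preimage_image_eq _) (E.linSecMap_p_surjective U k)
      ((F'.obj.realizationπ k U).app _ s)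
    obtain ⟨t, rfl⟩ := (hb E.mid U f).2 y
    refine ⟨t, (hb F' U f).1 ?_⟩
    rw [← hy]
    exact hπ E.p.hom U _ t

end Extension

end CohAlpha

/-! ### Coefficients of multiples in `k[M]` -/

namespace Lin

variable (k : Type u) [CommRing k] {A M : Type u} [CommMonoidWithZero A] [Zero M]
  [MulActionWithZero A M]

/-- Multiplication by `a` maps basis elements to basis elements or `0`, so only those attached to
multiples of `a` can occur in `a • x`. -/
theorem coeff_smul_eq_zero (a : A) {w : M} (hw : w ≠ 0) (h : ∀ v : M, a • v ≠ w) (x : Lin k M) :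
    coeff k hw (LinAlg.of k a • x) = 0 := by
  have : coeff k hw ∘ₗ act k A (LinAlg.of k a) = 0 := by
    apply hom_ext
    intro v
    change coeff k hw (LinAlg.of k a • of k v) = 0
    rw [of_smul_of, coeff_of_ne k hw (h v)]
  exact congr($this x)

/-- If `a • x` is a difference of two basis elements of `k[M]` then these are zero or multiples of
`a`. -/
theorem exists_smul_eq_of_smul_eq_sub [Nontrivial k] (a : A) {v w : M} (hvw : v ≠ w) (hv : v ≠ 0)
    {x : Lin k M} (h : LinAlg.of k a • x = of k v - of k w) : ∃ u : M, a • u = v := by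
  by_contra! hc
  have h1 := coeff_smul_eq_zero k a hv hc x
  rw [h, map_sub, coeff_of_self, coeff_of_ne k hv hvw.symm, sub_zero] at h1
  exact one_ne_zero h1

end Lin

namespace OModule

variable {X : MonoidScheme.{u}} (k : Type u) [CommRing k]

/-- The basis element of `k[F(U)]` attached to a section. -/
def linOf (F : OModule X.toMonoidalSpace) {U : Opens X.space} (s : F.sec U) : F.linSec k U :=
  Lin.of k s

theorem linSecMap_linOf {F G : OModule X.toMonoidalSpace} (φ : F ⟶ G) (U : Opens X.space)
    (s : F.sec U) : (linSecMap k φ U).hom (F.linOf k s) = G.linOf k (Hom.app φ U s) :=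
  Lin.map_of _ (Hom.map_zero φ U) s

theorem smul_linOf (F : OModule X.toMonoidalSpace) {U : Opens X.space} (a : X.sec U)
    (s : F.sec U) : (LinAlg.of k a • F.linOf k s : F.linSec k U) = F.linOf k (a • s) :=
  Lin.of_smul_of k a s

/-- If `a • x` is a difference of two sections then these are zero or multiples of `a`. -/
theorem exists_smul_eq_of_smul_eq_sub [Nontrivial k] (F : OModule X.toMonoidalSpace)
    {U : Opens X.space} (a : X.sec U) {v w : F.sec U} (hvw : v ≠ w) (hv : v ≠ 0)
    {x : F.linSec k U} (h : LinAlg.of k a • x = F.linOf k v - F.linOf k w) :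
    ∃ u : F.sec U, a • u = v :=
  Lin.exists_smul_eq_of_smul_eq_sub k a hvw hv h

end OModule

/-! ### The correspondence between the middle terms of two extensions -/

namespace CohAlpha.Extension

variable {X : MonoidScheme.{u}} {F' F : CohAlpha X}

/-- Sections of the middle terms of two extensions correspond to each other if they come from the
same section of the first term, or if they have the same non-zero image in the last term. -/
def Rel (E₁ E₂ : Extension F' F) {U : Opens X.space} (s : E₁.mid.obj.sec U)
    (t : E₂.mid.obj.sec U) : Prop :=
  (∃ v, s = OModule.Hom.app E₁.i.hom U v ∧ t = OModule.Hom.app E₂.i.hom U v) ∨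
    OModule.Hom.app E₁.p.hom U s = OModule.Hom.app E₂.p.hom U t ∧
      OModule.Hom.app E₁.p.hom U s ≠ 0

variable {E₁ E₂ : Extension F' F}

theorem Rel.symm {U : Opens X.space} {s : E₁.mid.obj.sec U} {t : E₂.mid.obj.sec U}
    (h : Rel E₁ E₂ s t) : Rel E₂ E₁ t s :=
  h.imp (fun ⟨v, h1, h2⟩ => ⟨v, h2, h1⟩) fun ⟨h1, h2⟩ => ⟨h1.symm, h1 ▸ h2⟩

theorem rel_app_i (U : Opens X.space) (v : F.obj.sec U) :
    Rel E₁ E₂ (OModule.Hom.app E₁.i.hom U v) (OModule.Hom.app E₂.i.hom U v) :=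
  .inl ⟨v, rfl, rfl⟩

section Affine

variable {U : X.AffineOpens}

theorem Rel.app_p_eq {s : E₁.mid.obj.sec U.1} {t : E₂.mid.obj.sec U.1} (h : Rel E₁ E₂ s t) :
    OModule.Hom.app E₁.p.hom U.1 s = OModule.Hom.app E₂.p.hom U.1 t := by
  rcases h with ⟨v, rfl, rfl⟩ | h
  · rw [app_p_app_i, app_p_app_i]
  · exact h.1

/-- Inside the kernel the injectivity of the first inclusion fixes the common source; outside it,
the second projection is injective. By symmetry and `exists_rel`, the correspondence is a bijection
over affine open sets. -/
theorem Rel.unique {s : E₁.mid.obj.sec U.1} {t t' : E₂.mid.obj.sec U.1} (h : Rel E₁ E₂ s t)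
    (h' : Rel E₁ E₂ s t') : t = t' := by
  by_cases h0 : OModule.Hom.app E₂.p.hom U.1 t = 0
  · rcases h with ⟨v, hv, rfl⟩ | h
    · rcases h' with ⟨v', hv', rfl⟩ | h'
      · rw [E₁.app_i_injective U (hv.symm.trans hv')]
      · rw [hv, app_p_app_i] at h'
        exact absurd rfl h'.2
    · exact absurd (h.1.trans h0) h.2
  · exact E₂.eq_of_app_p_eq U t t' h0 (h.app_p_eq.symm.trans h'.app_p_eq)

variable (E₂) in
theorem exists_rel (s : E₁.mid.obj.sec U.1) : ∃ t : E₂.mid.obj.sec U.1, Rel E₁ E₂ s t := by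
  by_cases h0 : OModule.Hom.app E₁.p.hom U.1 s = 0
  · obtain ⟨v, rfl⟩ := (E₁.app_p_eq_zero_iff U s).mp h0
    exact ⟨_, rel_app_i U.1 v⟩
  · obtain ⟨t, ht⟩ := E₂.app_p_surjective U (OModule.Hom.app E₁.p.hom U.1 s)
    exact ⟨t, .inr ⟨ht.symm, h0⟩⟩

/-- If a multiple of a section outside the kernel lies in the kernel of the projection, then it is
not a non-zero multiple of a section of the kernel. -/
theorem app_i_eq_zero_of_smul_eq (E : Extension F' F) {a : X.sec U.1} {s : E.mid.obj.sec U.1}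
    (hs : OModule.Hom.app E.p.hom U.1 s ≠ 0) {v : F.obj.sec U.1}
    (h : a • s = OModule.Hom.app E.i.hom U.1 (a • v)) : a • v = 0 := by
  have h1 : a • s = a • OModule.Hom.app E.i.hom U.1 v := by rw [h, OModule.Hom.app_smul]
  -- Type `α` of the middle term: the alternative that `s` equals the image of `v` would put `s` in
  -- the kernel.
  rcases E.mid.eq_or_smul_eq_zero U a _ _ h1 with h2 | h2
  · rw [h2, app_p_app_i] at hs
    exact absurd rfl hs
  · apply E.app_i_injective U
    rw [← h, h2, OModule.Hom.app_zero]

variable (k : Type u) [CommRing k] [Nontrivial k]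

/-- If two extensions become isomorphic after linearization, then the correspondence between the
sections of their middle terms is compatible with the action of the structure sheaf. -/
theorem Rel.smul (e : E₁.mid.obj.linSec k U.1 ⟶ E₂.mid.obj.linSec k U.1)
    (hi : OModule.linSecMap k E₁.i.hom U.1 ≫ e = OModule.linSecMap k E₂.i.hom U.1)
    (hp : e ≫ OModule.linSecMap k E₂.p.hom U.1 = OModule.linSecMap k E₁.p.hom U.1)
    (a : X.sec U.1) {s : E₁.mid.obj.sec U.1} {t : E₂.mid.obj.sec U.1} (h : Rel E₁ E₂ s t) :
    Rel E₁ E₂ (a • s) (a • t) := by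
  rcases h with ⟨v, rfl, rfl⟩ | ⟨hst, hs⟩
  · rw [← OModule.Hom.app_smul, ← OModule.Hom.app_smul]
    exact rel_app_i _ _
  have hast : OModule.Hom.app E₁.p.hom U.1 (a • s) = OModule.Hom.app E₂.p.hom U.1 (a • t) := by
    rw [OModule.Hom.app_smul, OModule.Hom.app_smul, hst]
  by_cases h0 : OModule.Hom.app E₁.p.hom U.1 (a • s) = 0
  swap
  · exact .inr ⟨hast, h0⟩
  -- This is the critical case: multiplication by `a` moves `s` and `t` into the kernels, where
  -- partners must have the same source in `F(U)`.
  obtain ⟨v₁, hv₁⟩ := (E₁.app_p_eq_zero_iff U _).mp h0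
  obtain ⟨v₂, hv₂⟩ := (E₂.app_p_eq_zero_iff U _).mp (hast.symm.trans h0)
  suffices v₁ = v₂ by
    subst this
    exact .inl ⟨v₁, hv₁.symm, hv₂.symm⟩
  have hi' : ∀ v, e.hom (E₁.mid.obj.linOf k (OModule.Hom.app E₁.i.hom U.1 v)) =
      E₂.mid.obj.linOf k (OModule.Hom.app E₂.i.hom U.1 v) := by
    intro v
    rw [← OModule.linSecMap_linOf, ← OModule.linSecMap_linOf, ← hi]
    rfl
  -- The linear map `e` need not send `s` to `t`, but the two have the same image in `k[F'(U)]`, so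
  -- they differ by an element `δ` of `k[F(U)]`.
  have hp' : (OModule.linSecMap k E₂.p.hom U.1).hom
      (e.hom (E₁.mid.obj.linOf k s) - E₂.mid.obj.linOf k t) = 0 := by
    have h1 : (OModule.linSecMap k E₂.p.hom U.1).hom (e.hom (E₁.mid.obj.linOf k s)) =
        F'.obj.linOf k (OModule.Hom.app E₁.p.hom U.1 s) := by
      rw [← OModule.linSecMap_linOf, ← hp]
      rfl
    rw [map_sub, h1, hst, OModule.linSecMap_linOf, sub_self]
  obtain ⟨δ, hδ⟩ := E₂.exists_linSecMap_i_eq U k _ hp'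
  -- Multiply by `a`: by linearity `e` sends `a • s`, the image of `v₁` in the first extension, to
  -- the image of `v₁` in the second.
  have hδ' : LinAlg.of k a • δ = F.obj.linOf k v₁ - F.obj.linOf k v₂ := by
    apply E₂.linSecMap_i_injective U k
    rw [map_sub, OModule.linSecMap_linOf, OModule.linSecMap_linOf, hv₂, ← hi', hv₁,
      ← OModule.smul_linOf, ← OModule.smul_linOf]
    refine ((OModule.linSecMap k E₂.i.hom U.1).hom.map_smul (LinAlg.of k a) δ).trans ?_
    rw [hδ]
    refine (smul_sub (LinAlg.of k a) _ _).trans ?_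
    exact congrArg (· - _) (e.hom.map_smul (LinAlg.of k a) (E₁.mid.obj.linOf k s)).symm
  by_contra hne
  -- If `v₁ ≠ v₂`, a non-zero one of them is a multiple of `a`, which type `α` excludes. When `v₁ =
  -- 0`, the argument runs with `v₂` and `-δ`.
  rcases eq_or_ne v₁ 0 with h1 | h1
  · have h2 : v₂ ≠ 0 := fun h => hne (h1.trans h.symm)
    obtain ⟨v, rfl⟩ := F.obj.exists_smul_eq_of_smul_eq_sub k a (Ne.symm hne) h2 (x := -δ)
      ((smul_neg (LinAlg.of k a) δ).trans ((congrArg _ hδ').trans (neg_sub _ _)))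
    exact h2 (E₂.app_i_eq_zero_of_smul_eq (hst ▸ hs) hv₂.symm)
  · obtain ⟨v, rfl⟩ := F.obj.exists_smul_eq_of_smul_eq_sub k a hne h1 hδ'
    exact h1 (E₁.app_i_eq_zero_of_smul_eq hs hv₁.symm)

end Affine

/-- The problem is a section outside the kernel whose restriction to `V = D(f)` falls into it. Then
some `f ^ n • s` already lies in the kernel over `U`, and the correspondence for `f ^ n • s` and `f
^ n • t` can be divided by `f ^ n` over `V`. This is why compatibility with the action is assumed.
-/
theorem Rel.res {U V : X.AffineOpens} (h : V ≤ U) {s : E₁.mid.obj.sec U.1}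
    {t : E₂.mid.obj.sec U.1}
    (hsmul : ∀ a : X.sec U.1, Rel E₁ E₂ (a • s) (a • t)) :
    Rel E₁ E₂ (E₁.mid.obj.res h s) (E₂.mid.obj.res h t) := by
  have hst : Rel E₁ E₂ s t := by simpa using hsmul 1
  by_cases h0 : OModule.Hom.app E₁.p.hom V.1 (E₁.mid.obj.res h s) = 0
  swap
  · refine .inr ⟨?_, h0⟩
    rw [OModule.Hom.app_res, OModule.Hom.app_res, hst.app_p_eq]
  obtain ⟨c⟩ := U.2
  obtain ⟨V, hV⟩ := V
  obtain ⟨f, rfl⟩ := c.exists_eq_basicOpen hV h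
  rw [OModule.Hom.app_res, ← F'.obj.res_zero h] at h0
  obtain ⟨n, hn⟩ := (F'.isCoherent.affine c).1.exists_of_eq f _ _ h0
  rw [smul_zero, ← OModule.Hom.app_smul] at hn
  obtain ⟨v, hv, hv'⟩ : ∃ v, f ^ n • s = OModule.Hom.app E₁.i.hom U.1 v ∧
      f ^ n • t = OModule.Hom.app E₂.i.hom U.1 v :=
    (hsmul (f ^ n)).resolve_right fun h => h.2 hn
  have hu := c.isUnit_res f n
  obtain ⟨b, hb⟩ := hu.exists_left_inv
  refine .inl ⟨b • F.obj.res h v, ?_, ?_⟩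
  · rw [OModule.Hom.app_smul, OModule.Hom.app_res, ← hv, OModule.res_smul, smul_smul, hb, one_smul]
  · rw [OModule.Hom.app_smul, OModule.Hom.app_res, ← hv', OModule.res_smul, smul_smul, hb, one_smul]

end CohAlpha.Extension

/-! ### Full faithfulness of `M ↦ M~` -/

namespace AlgebraicGeometry.Scheme.Modules

theorem exists_tilde_map_eq {R : CommRingCat.{u}} {M N : ModuleCat.{u} R}
    (f : tilde M ⟶ tilde N) : ∃ g : M ⟶ N, tilde.map g = f :=
  (tilde.functor R).map_surjective f

theorem tilde_map_injective {R : CommRingCat.{u}} {M N : ModuleCat.{u} R} {g h : M ⟶ N}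
    (H : tilde.map g = tilde.map h) : g = h :=
  (tilde.functor R).map_injective H

end AlgebraicGeometry.Scheme.Modules

/-! ### Morphisms determined on affine open sets -/

namespace OModule

variable {X : MonoidScheme.{u}}

/-- Morphisms are determined by their action on sections over affine open sets. -/
theorem hom_ext_of_affine {F G : OModule X.toMonoidalSpace} {φ ψ : F ⟶ G}
    (h : ∀ (U : X.AffineOpens) (s : F.sec U.1), Hom.app φ U.1 s = Hom.app ψ U.1 s) : φ = ψ := by
  apply Hom.ext
  ext W s
  refine G.sec_ext (s := Hom.app φ W s) (t := Hom.app ψ W s) fun U hU => ?_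
  rw [← Hom.app_res, ← Hom.app_res, h]

/-- A compatible family of equivariant maps on affine open sets extends to a morphism. -/
theorem exists_hom_of_affine {F G : OModule X.toMonoidalSpace}
    (ψ : ∀ U : X.AffineOpens, F.sec U.1 → G.sec U.1)
    (hψ : ∀ (U V : X.AffineOpens) (h : V.1 ≤ U.1) (s : F.sec U.1),
      ψ V (F.res h s) = G.res h (ψ U s))
    (hsmul : ∀ (U : X.AffineOpens) (a : X.sec U.1) (s : F.sec U.1), ψ U (a • s) = a • ψ U s) :
    ∃ φ : F ⟶ G, ∀ (U : X.AffineOpens) (s : F.sec U.1), Hom.app φ U.1 s = ψ U s := by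
  have hB : Opens.IsBasis (Set.range (Subtype.val : X.AffineOpens → Opens X.space)) := by
    rw [Subtype.range_coe_subtype]
    exact X.isBasis_affineOpens
  let α : (inducedFunctor (Subtype.val : X.AffineOpens → Opens X.space)).op ⋙ F.presheaf ⟶
      (inducedFunctor (Subtype.val : X.AffineOpens → Opens X.space)).op ⋙ G.presheaf :=
    { app U := ↾(ψ U.unop)
      naturality U V f := by
        ext s
        exact hψ _ _ f.unop.hom.le s }
  -- Since `G` is a sheaf, a natural family on a basis of open sets extends to all open sets.
  let β := TopCat.Sheaf.restrictHomEquivHom F.presheaf ⟨G.presheaf, G.isSheaf⟩ hB α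
  have hβ : ∀ (U : X.AffineOpens) (s : F.sec U.1), β.app (op U.1) s = ψ U s := fun U s =>
    congr($(TopCat.Sheaf.extend_hom_app F.presheaf ⟨G.presheaf, G.isSheaf⟩ hB α U) s)
  have hres : ∀ {U V : Opens X.space} (h : V ≤ U) (s : F.sec U),
      G.res h (β.app (op U) s) = β.app (op V) (F.res h s) := fun h s =>
    congr($(β.naturality (homOfLE h).op) s).symm
  refine ⟨⟨β, fun W => ?_, fun W a s => ?_⟩, hβ⟩
  · refine G.sec_ext fun U hU => ?_
    refine (hres hU 0).trans ?_
    -- Writing the base point as `0 • 0` makes its preservation a case of equivariance.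
    rw [res_zero, hβ, res_zero, ← zero_smul (X.sec U.1) (0 : F.sec U.1), hsmul, zero_smul]
  · refine G.sec_ext fun U hU => ?_
    refine (hres hU (a • s)).trans ?_
    rw [res_smul, hβ, hsmul, ← hβ, ← hres hU s]
    exact (G.res_smul hU a _).symm

variable (k : Type u) [CommRing k] {F G H : OModule X.toMonoidalSpace} {U : X.AffineOpens}

/-- On affine open sets, morphisms of realizations come from linear maps. -/
theorem exists_linSec_hom (hF : F.IsCoherent) (ε : F.realization k ⟶ G.realization k)
    (U : X.AffineOpens) : ∃ e : F.linSec k U.1 ⟶ G.linSec k U.1,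
      F.realizationRestrictHom k U ≫ tilde.map e =
        (Scheme.Modules.restrictFunctor (X.realizationι k U)).map ε ≫
          G.realizationRestrictHom k U := by
  have := isIso_realizationRestrictHom k hF U
  obtain ⟨e, he⟩ := Scheme.Modules.exists_tilde_map_eq (inv (F.realizationRestrictHom k U) ≫
    (Scheme.Modules.restrictFunctor (X.realizationι k U)).map ε ≫ G.realizationRestrictHom k U)
  exact ⟨e, by rw [he, IsIso.hom_inv_id_assoc]⟩

/-- The comparison with `k[F(U)]~` is an isomorphism and `M ↦ M~` is faithful, so identities between
morphisms of realizations descend to identities between linear maps over `U`. -/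
theorem linSec_hom_ext (hF : F.IsCoherent) {ε : F.realization k ⟶ G.realization k}
    {e e' : F.linSec k U.1 ⟶ G.linSec k U.1}
    (he : F.realizationRestrictHom k U ≫ tilde.map e =
        (Scheme.Modules.restrictFunctor (X.realizationι k U)).map ε ≫
          G.realizationRestrictHom k U)
    (he' : F.realizationRestrictHom k U ≫ tilde.map e' =
        (Scheme.Modules.restrictFunctor (X.realizationι k U)).map ε ≫
          G.realizationRestrictHom k U) : e = e' := by
  have := isIso_realizationRestrictHom k hF U
  exact Scheme.Modules.tilde_map_injective
    ((cancel_epi (F.realizationRestrictHom k U)).mp (he.trans he'.symm))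

theorem restrict_comp {ε : F.realization k ⟶ G.realization k}
    {δ : G.realization k ⟶ H.realization k}
    {e : F.linSec k U.1 ⟶ G.linSec k U.1} {d : G.linSec k U.1 ⟶ H.linSec k U.1}
    (he : F.realizationRestrictHom k U ≫ tilde.map e =
        (Scheme.Modules.restrictFunctor (X.realizationι k U)).map ε ≫
          G.realizationRestrictHom k U)
    (hd : G.realizationRestrictHom k U ≫ tilde.map d =
        (Scheme.Modules.restrictFunctor (X.realizationι k U)).map δ ≫
          H.realizationRestrictHom k U) :
    F.realizationRestrictHom k U ≫ tilde.map (e ≫ d) =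
      (Scheme.Modules.restrictFunctor (X.realizationι k U)).map (ε ≫ δ) ≫
        H.realizationRestrictHom k U := by
  rw [tilde.map_comp, reassoc_of% he, hd, Functor.map_comp, Category.assoc]

end OModule

/-! ### From equivalent realizations to equivalent extensions -/

namespace CohAlpha

variable {X : MonoidScheme.{u}}

/-- An isomorphism of underlying modules is an isomorphism in `Coh^α(X)`. -/
def isoMk {G H : CohAlpha X} (e : G.obj ≅ H.obj) : G ≅ H where
  hom := ⟨e.hom, fun x s t _ h => by
    rw [← OModule.Hom.stalkMap_id _ x s, ← OModule.Hom.stalkMap_id _ x t, ← e.hom_inv_id,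
      OModule.Hom.stalkMap_comp, OModule.Hom.stalkMap_comp, h]⟩
  inv := ⟨e.inv, fun x s t _ h => by
    rw [← OModule.Hom.stalkMap_id _ x s, ← OModule.Hom.stalkMap_id _ x t, ← e.inv_hom_id,
      OModule.Hom.stalkMap_comp, OModule.Hom.stalkMap_comp, h]⟩
  hom_inv_id := Hom.ext e.hom_inv_id
  inv_hom_id := Hom.ext e.inv_hom_id

namespace Extension

variable {F' F : CohAlpha X}

/-- Over each affine open set every section has exactly one partner. This uniqueness turns the
compatibility of the correspondence with restriction and with the action into naturality and
equivariance of the map, which then glues. -/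
theorem exists_hom_rel {E₁ E₂ : Extension F' F}
    (hsmul : ∀ (U : X.AffineOpens) (a : X.sec U.1) (s : E₁.mid.obj.sec U.1)
      (t : E₂.mid.obj.sec U.1), Rel E₁ E₂ s t → Rel E₁ E₂ (a • s) (a • t)) :
    ∃ φ : E₁.mid.obj ⟶ E₂.mid.obj, ∀ (U : X.AffineOpens) (s : E₁.mid.obj.sec U.1),
      Rel E₁ E₂ s (OModule.Hom.app φ U.1 s) := by
  choose ψ hψ using fun U : X.AffineOpens => exists_rel (E₁ := E₁) E₂ (U := U)
  obtain ⟨φ, hφ⟩ := OModule.exists_hom_of_affine ψ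
    (fun U V h s => (hψ V _).unique (Rel.res h fun a => hsmul U a _ _ (hψ U s)))
    (fun U a s => (hψ U _).unique (hsmul U a _ _ (hψ U s)))
  exact ⟨φ, fun U s => hφ U s ▸ hψ U s⟩

/-- If the correspondence between the sections of the middle terms is compatible with the action
of the structure sheaf, then the extensions are equivalent. -/
theorem equiv_of_rel_smul {E₁ E₂ : Extension F' F}
    (hsmul : ∀ (U : X.AffineOpens) (a : X.sec U.1) (s : E₁.mid.obj.sec U.1)
      (t : E₂.mid.obj.sec U.1), Rel E₁ E₂ s t → Rel E₁ E₂ (a • s) (a • t)) : E₁ ≈ E₂ := by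
  obtain ⟨φ, hφ⟩ := exists_hom_rel hsmul
  obtain ⟨ψ, hψ⟩ := exists_hom_rel (E₁ := E₂) (E₂ := E₁)
    fun U a s t h => (hsmul U a t s h.symm).symm
  -- The inverse is built from the reversed correspondence. Uniqueness of partners gives both
  -- inverse laws and compatibility with the inclusions; for the projections, partners have equal
  -- images.
  refine ⟨isoMk ⟨φ, ψ, ?_, ?_⟩, Hom.ext ?_, Hom.ext ?_⟩
  · exact OModule.hom_ext_of_affine fun U s => (hψ U _).unique (hφ U s).symm
  · exact OModule.hom_ext_of_affine fun U s => (hφ U _).unique (hψ U s).symm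
  · exact OModule.hom_ext_of_affine fun U v => (hφ U _).unique (rel_app_i U.1 v)
  · exact OModule.hom_ext_of_affine fun U s => (hφ U s).app_p_eq.symm

variable (k : Type u) [CommRing k] [Nontrivial k]

/-- Extensions with equivalent realizations are equivalent. -/
theorem equiv_of_realization_iso {E₁ E₂ : Extension F' F}
    (ε : E₁.mid.obj.realization k ⟶ E₂.mid.obj.realization k)
    (hi : OModule.realizationMap k E₁.i.hom ≫ ε = OModule.realizationMap k E₂.i.hom)
    (hp : ε ≫ OModule.realizationMap k E₂.p.hom = OModule.realizationMap k E₁.p.hom) :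
    E₁ ≈ E₂ := by
  refine equiv_of_rel_smul fun U a s t h => ?_
  obtain ⟨e, he⟩ := OModule.exists_linSec_hom k E₁.mid.isCoherent ε U
  -- The isomorphism is used only through its linear map `e` over `U`, which inherits both
  -- commutative triangles from `ε`.
  refine h.smul k e ?_ ?_ a
  · refine OModule.linSec_hom_ext k F.isCoherent ?_
      (OModule.realizationRestrictHom_naturality k _ U)
    rw [← hi]
    exact OModule.restrict_comp k (OModule.realizationRestrictHom_naturality k _ U) he
  · refine OModule.linSec_hom_ext k E₁.mid.isCoherent ?_
      (OModule.realizationRestrictHom_naturality k _ U)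
    rw [← hp]
    exact OModule.restrict_comp k he (OModule.realizationRestrictHom_naturality k _ U)

section Realize

variable {k : Type u} [CommRing k]
  {hc : ∀ G : CohAlpha X,
    isCoherentModule (X.realization k) ((OModule.realizationFunctor k X).obj G.obj)}
  {E₁ E₂ : Extension F' F}
  {hz₁ : (OModule.realizationFunctor k X).map E₁.i.hom ≫
    (OModule.realizationFunctor k X).map E₁.p.hom = 0}
  {hs₁ : (ShortComplex.mk _ _ hz₁).ShortExact}
  {hz₂ : (OModule.realizationFunctor k X).map E₂.i.hom ≫
    (OModule.realizationFunctor k X).map E₂.p.hom = 0}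
  {hs₂ : (ShortComplex.mk _ _ hz₂).ShortExact}

theorem realize_equiv (h : E₁ ≈ E₂) : E₁.realize k hc hz₁ hs₁ ≈ E₂.realize k hc hz₂ hs₂ := by
  obtain ⟨e, hi, hp⟩ := h
  have hi' : E₁.i.hom ≫ e.hom.hom = E₂.i.hom := congrArg Hom.hom hi
  have hp' : e.hom.hom ≫ E₂.p.hom = E₁.p.hom := congrArg Hom.hom hp
  let e' : E₁.mid.obj ≅ E₂.mid.obj :=
    ⟨e.hom.hom, e.inv.hom, congrArg Hom.hom e.hom_inv_id, congrArg Hom.hom e.inv_hom_id⟩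
  refine ⟨ObjectProperty.isoMk _ ((OModule.realizationFunctor k X).mapIso e'),
    ObjectProperty.hom_ext _ ?_, ObjectProperty.hom_ext _ ?_⟩
  · change (OModule.realizationFunctor k X).map E₁.i.hom ≫
      (OModule.realizationFunctor k X).map e.hom.hom = (OModule.realizationFunctor k X).map E₂.i.hom
    rw [← Functor.map_comp, hi']
  · change (OModule.realizationFunctor k X).map e.hom.hom ≫
      (OModule.realizationFunctor k X).map E₂.p.hom = (OModule.realizationFunctor k X).map E₁.p.hom
    rw [← Functor.map_comp, hp']

theorem equiv_of_realize_equiv [Nontrivial k]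
    (h : E₁.realize k hc hz₁ hs₁ ≈ E₂.realize k hc hz₂ hs₂) : E₁ ≈ E₂ := by
  obtain ⟨ε, hi, hp⟩ := h
  exact equiv_of_realization_iso k ε.hom.hom (congrArg (·.hom) hi) (congrArg (·.hom) hp)

end Realize

end Extension

end CohAlpha

end

theorem proposition4p5 (X : MonoidScheme.{u}) [X.IsFiniteType] (k : Type u) [Field k]
    (F' F : CohAlpha X) :
    -- realization sends coherent type-`α` sheaves to coherent sheaves on `X_k`,
    -- and extensions of `F'` by `F` to extensions of `F'_k` by `F_k`
    ∃ (hc : ∀ G : CohAlpha X,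
        isCoherentModule (X.realization k) ((OModule.realizationFunctor k X).obj G.obj))
      (hz : ∀ E : CohAlpha.Extension F' F,
        (OModule.realizationFunctor k X).map E.i.hom ≫
          (OModule.realizationFunctor k X).map E.p.hom = 0)
      (hs : ∀ E : CohAlpha.Extension F' F, (ShortComplex.mk _ _ (hz E)).ShortExact),
      -- and the induced map on equivalence classes exists and is injective
      ∃ Φ : CohAlpha.Ext F' F → Coh.Ext (Y := X.realization k) ⟨_, hc F'⟩ ⟨_, hc F⟩,
        (∀ E : CohAlpha.Extension F' F,
          Φ (Quotient.mk _ E) = Quotient.mk _ (E.realize k hc (hz E) (hs E))) ∧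
        Function.Injective Φ := by
  have hc : ∀ G : CohAlpha X,
      isCoherentModule (X.realization k) ((OModule.realizationFunctor k X).obj G.obj) :=
    fun G => OModule.isCoherentModule_realization k G.isCoherent
  refine ⟨hc, fun E => E.realizationMap_comp_eq_zero k, fun E => E.shortExact_realization k,
    Quotient.lift (fun E => Quotient.mk _ (E.realize k hc (E.realizationMap_comp_eq_zero k)
      (E.shortExact_realization k))) ?_, fun _ => rfl, ?_⟩
  · exact fun E₁ E₂ h => Quotient.sound (CohAlpha.Extension.realize_equiv h)
  · rintro ⟨E₁⟩ ⟨E₂⟩ h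
    exact Quotient.sound (CohAlpha.Extension.equiv_of_realize_equiv (Quotient.exact h))
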